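/- **Setting.** Let $(\Omega,\mathcal F)$ be a measurable space and $\mathscr H$ a linear space of real measurable functions on $\Omega$ such that $\psi(Y_1,\dots,Y_n)\in\mathscr H$ whenever $Y_1,\dots,Y_n\in\mathscr H$ and $\psi:\mathbb R^n\to\mathbb R$ satisfies $|\psi(x)-\psi(y)|\le C(1+|x|^m+|y|^m)|x-y|$ for some $C>0$, $m\in\mathbb N$. Let $\hat{\mathbb E}:\mathscr H\to[-\infty,\infty]$ be a sub-linear expectation, i.e. monotone, with $\hat{\mathbb E}[c]=c$ for constants $c$, $\hat{\mathbb E}[X+Y]\le\hat{\mathbb E}[X]+\hat{\mathbb E}[Y]$ whenever the right side is not of the form $\infty-\infty$, and $\hat{\mathbb E}[\lambda X]=\lambda\hat{\mathbb E}[X]$ for $\lambda\ge0$. Let $\mathscr H_b$ be the set of bounded elements of $\mathscr H$. Define $$\widehat{\mathbb V}(A)=\inf\{\hat{\mathbb E}[\xi]:I_A\le\xi,\ \xi\in\mathscr H\},\qquad \widehat{\mathbb V}^*(A)=\inf\Big\{\sum_{n\ge1}\widehat{\mathbb V}(A_n):A\subset\bigcup_{n\ge1} A_n,\ A_n\in\mathcal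 F\Big\},\qquad A\in\mathcal F.$$ Let $X_1,X_2,\ldots\in\mathscr H$ be i.i.d. under $\hat{\mathbb E}$: for all $i\ge1$, $\hat{\mathbb E}[\psi(X_i)]=\hat{\mathbb E}[\psi(X_1)]$ for every bounded Lipschitz $\psi$ on $\mathbb R$, and $\hat{\mathbb E}[\psi(X_1,\dots,X_{i+1})]=\hat{\mathbb E}\big[\hat{\mathbb E}[\psi(x_1,\dots,x_i,X_{i+1})]\big|_{x_1=X_1,\dots,x_i=X_i}\big]$ for every bounded Lipschitz $\psi$ on $\mathbb R^{i+1}$. Assume that the Choquet expectation of $|X_1|$ is finite, $\int_0^\infty\widehat{\mathbb V}(|X_1|\ge t)\,dt<\infty$. Put $\bm X=(X_1,X_2,\ldots)$ and $S_n=\sum_{i=1}^nX_i$. Let $\mathscr P$ be a family of probability measures on $\sigma(\mathscr H)$ such that $\hat{\mathbb E}[Y]=\sup_{P\in\mathscr P}E_P[Y]$ for all $Y\in\mathscr H_b$ and such that, for all $Y_1,Y_2,\ldots\in\mathscr H_b$, the set $\{P\circ(Y_1,Y_2,\ldots)^{-1}:P\in\mathscr P\}$ of laws is weakly compact in the space of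 probability measures on $\mathbb R^{\mathbb N}$ (with the product topology). Let $\mathbb L_c$ be the completion of $C_b(\mathbb R^{\mathbb N})$ under $\sup_{P\in\mathscr P}E_P[|\,\cdot\,(\bm X)|]$, that is, the set of Borel functions $\varphi:\mathbb R^{\mathbb N}\to\mathbb R$ such that for every $\varepsilon>0$ there is $f\in C_b(\mathbb R^{\mathbb N})$ with $\sup_{P\in\mathscr P}E_P[|\varphi(\bm X)-f(\bm X)|]\le\varepsilon$. **Statement.** The limits $\overline\mu=\lim_{c\to\infty}\hat{\mathbb E}[(-c)\vee X_1\wedge c]$ and $\underline\mu=-\lim_{c\to\infty}\hat{\mathbb E}[(-c)\vee(-X_1)\wedge c]$ exist and are finite, and the following holds. (a) For every $d$ and every Borel measurable $\varphi:\mathbb R^d\to\mathbb R$ there is a probability measure $Q$ on $(\Omega,\sigma(\mathscr H))$ such that $E_Q[Y]\le\hat{\mathbb E}[Y]$ for all $Y\in\mathscr H_b$ and $$\widehat{\mathbb V}^*\Big(\lim_{n\to\infty}\frac{S_n}{n}=\underline\mu\vee\varphi(X_1,\ldots,X_d)\wedge\overline\mu\Big)=Q\Big(\lim_{n\to\infty}\frac{S_n}{n}=\underline\mu\vee\varphi(X_1,\ldots,X_d)\wedge\overline\mu\Big)=1.$$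 (b) For every continuous $\varphi:\mathbb R^{\mathbb N}\to\mathbb R$ there is $P\in\mathscr P$ such that $$\widehat{\mathbb V}^*\Big(\lim_{n\to\infty}\frac{S_n}{n}=\underline\mu\vee\varphi(\bm X)\wedge\overline\mu\Big)=P\Big(\lim_{n\to\infty}\frac{S_n}{n}=\underline\mu\vee\varphi(\bm X)\wedge\overline\mu\Big)=1.$$ The conclusion of (b) also holds for every $\varphi\in\mathbb L_c$. -/

import Mathlib

open Filter Topology MeasureTheory
open scoped ENNReal BoundedContinuousFunction

noncomputable section

namespace SubLin

/-- The class `C_{l,Lip}(ℝⁿ)` of local Lipschitz functions with polynomial growth. (The sup norm of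
`Fin n → ℝ` is equivalent to the Euclidean norm, hence yields the same class of functions.) -/
def LocLip {n : ℕ} (φ : (Fin n → ℝ) → ℝ) : Prop :=
  ∃ C : ℝ, ∃ m : ℕ, 0 < C ∧
    ∀ x y : Fin n → ℝ, |φ x - φ y| ≤ C * (1 + ‖x‖ ^ m + ‖y‖ ^ m) * ‖x - y‖

/-- Bounded Lipschitz functions, `C_{b,Lip}`. -/
def BddLip {E : Type*} [PseudoEMetricSpace E] (φ : E → ℝ) : Prop :=
  (∃ K, LipschitzWith K φ) ∧ ∃ M : ℝ, ∀ x, |φ x| ≤ M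

/-- The datum `(ℋ, 𝔼)` of a sub-linear expectation space over the measurable space `Ω`. The
expectation is written as a total function; its values outside `ℋ` are irrelevant. -/
structure SubLinSpace (Ω : Type*) [MeasurableSpace Ω] where
  /-- the linear space `ℋ` of random variables -/
  H : Submodule ℝ (Ω → ℝ)
  measurable_of_mem : ∀ X ∈ H, Measurable X
  comp_mem : ∀ (n : ℕ) (X : Fin n → Ω → ℝ), (∀ i, X i ∈ H) →
    ∀ φ : (Fin n → ℝ) → ℝ, LocLip φ → (fun ω => φ (fun i => X i ω)) ∈ H
  /-- the sub-linear expectation -/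
  E : (Ω → ℝ) → EReal
  mono : ∀ X ∈ H, ∀ Y ∈ H, (∀ ω, Y ω ≤ X ω) → E Y ≤ E X
  const : ∀ c : ℝ, E (fun _ => c) = (c : EReal)
  subadd : ∀ X ∈ H, ∀ Y ∈ H, ¬ (E X = ⊤ ∧ E Y = ⊥) → ¬ (E X = ⊥ ∧ E Y = ⊤) →
    E (fun ω => X ω + Y ω) ≤ E X + E Y
  homog : ∀ X ∈ H, ∀ r : ℝ, 0 ≤ r → E (fun ω => r * X ω) = (r : EReal) * E X

namespace SubLinSpace

variable {Ω : Type*} [MeasurableSpace Ω] (S : SubLinSpace Ω)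

/-- The bounded elements `ℋ_b` of `ℋ`. -/
def Hb : Set (Ω → ℝ) := {X | X ∈ S.H ∧ ∃ M : ℝ, ∀ ω, |X ω| ≤ M}

/-- The `σ`-algebra `σ(ℋ)`. -/
@[reducible] def sigma : MeasurableSpace Ω :=
  ⨆ X ∈ S.H, MeasurableSpace.comap X (borel ℝ)

/-- Probability measures on `(Ω, σ(ℋ))`. -/
abbrev Prob : Type _ := @ProbabilityMeasure Ω S.sigma

/-- Two random vectors (possibly on different spaces) are identically distributed. -/
def IdentDist {Ω' : Type*} [MeasurableSpace Ω'] (S' : SubLinSpace Ω') {n : ℕ}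
    (X : Fin n → Ω → ℝ) (Y : Fin n → Ω' → ℝ) : Prop :=
  ∀ φ : (Fin n → ℝ) → ℝ, BddLip φ →
    S.E (fun ω => φ (fun i => X i ω)) = S'.E (fun ω => φ (fun i => Y i ω))

/-- The random vector `Y` is independent to the random vector `X`. For bounded `φ` the inner
expectation is a finite number. -/
def IndepTo {m n : ℕ} (Y : Fin n → Ω → ℝ) (X : Fin m → Ω → ℝ) : Prop :=
  ∀ φ : (Fin m → ℝ) × (Fin n → ℝ) → ℝ, BddLip φ →
    S.E (fun ω => φ (fun i => X i ω, fun j => Y j ω)) =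
      S.E (fun ω => (S.E (fun ω' => φ (fun i => X i ω, fun j => Y j ω'))).toReal)

/-- An independent and identically distributed sequence in `ℋ`; the variables `X₁, X₂, …` are
`X 0, X 1, …`. -/
structure IsIID (X : ℕ → Ω → ℝ) : Prop where
  mem : ∀ i, X i ∈ S.H
  ident : ∀ i, S.IdentDist S (fun _ : Fin 1 => X i) (fun _ : Fin 1 => X 0)
  indep : ∀ i : ℕ, S.IndepTo (fun _ : Fin 1 => X (i + 1)) (fun j : Fin (i + 1) => X j)

/-- The upper capacity `𝕍(A) = inf {𝔼[ξ] : I_A ≤ ξ, ξ ∈ ℋ}` (the numbers `𝔼[ξ]` are all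
nonnegative). -/
def upCap (A : Set Ω) : ℝ≥0∞ :=
  ⨅ (ξ : Ω → ℝ) (_ : ξ ∈ S.H) (_ : ∀ ω, A.indicator (fun _ => (1 : ℝ)) ω ≤ ξ ω),
    (S.E ξ).toENNReal

/-- The countably sub-additive extension `𝕍^*` of the upper capacity; the covers consist of
events of the underlying measurable space. -/
def outCap (A : Set Ω) : ℝ≥0∞ :=
  ⨅ (B : ℕ → Set Ω) (_ : ∀ n, MeasurableSet (B n)) (_ : A ⊆ ⋃ n, B n), ∑' n, S.upCap (B n)

/-- The truncation `X^{(c)} = (-c) ∨ X ∧ c`. -/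
def trunc (c : ℝ) (X : Ω → ℝ) : Ω → ℝ := fun ω => max (-c) (min (X ω) c)

/-- `m` is the limit of `𝔼[X^{(c)}]` as `c → ∞`. -/
def IsTruncMean (X : Ω → ℝ) (m : ℝ) : Prop :=
  Tendsto (fun c : ℝ => S.E (trunc c X)) atTop (𝓝 (m : EReal))

/-- The condition (CC): `𝔼` is represented on `ℋ_b` by the family `Pfam`, and `Pfam` is
countable-dimensionally weakly compact. The product topology of `ℕ → ℝ` is the one of the metric
`∑ (|xᵢ - yᵢ| ∧ 1) / 2ⁱ`, and `ProbabilityMeasure` carries the topology of weak convergence. -/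
structure CC (Pfam : Set S.Prob) : Prop where
  repr : ∀ X ∈ S.Hb, S.E X = ⨆ P ∈ Pfam, ((∫ ω, X ω ∂P.1 : ℝ) : EReal)
  compact : ∀ Y : ℕ → Ω → ℝ, (∀ n, Y n ∈ S.Hb) →
    IsCompact {ν : ProbabilityMeasure (ℕ → ℝ) |
      ∃ P ∈ Pfam, ∀ A : Set (ℕ → ℝ), MeasurableSet A →
        ν.1 A = P.1 {ω | (fun n => Y n ω) ∈ A}}

/-- The space `𝕃_c`: the Borel functions `φ` on `ℝ^ℕ` that are limits of bounded continuous
functions `f` in the norm `sup_{P ∈ Pfam} E_P[|φ(X) - f(X)|]`. -/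
def MemLc (Pfam : Set S.Prob) (X : ℕ → Ω → ℝ) (φ : (ℕ → ℝ) → ℝ) : Prop :=
  Measurable φ ∧ ∀ ε : ℝ≥0∞, 0 < ε → ∃ f : (ℕ → ℝ) →ᵇ ℝ,
    (⨆ P ∈ Pfam, ∫⁻ ω, ENNReal.ofReal |φ (fun n => X n ω) - f (fun n => X n ω)| ∂P.1) ≤ ε

end SubLinSpace

/-- The Choquet integral
`∫_0^∞ V(X ≥ t) dt + ∫_{-∞}^0 (V(X ≥ t) - 1) dt` for a capacity `V` with values in `[0, 1]`. -/
def choquet {Ω : Type*} (V : Set Ω → ℝ≥0∞) (X : Ω → ℝ) : EReal :=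
  ((∫⁻ t in Set.Ioi (0 : ℝ), V {ω | t ≤ X ω} : ℝ≥0∞) : EReal) -
    ((∫⁻ t in Set.Iio (0 : ℝ), (1 - V {ω | t ≤ X ω}) : ℝ≥0∞) : EReal)

/-- The event `lim S_n / n = μlo ∨ Z ∧ μhi`, where `S_n = X₁ + ⋯ + X_n`. -/
def limEvent {Ω : Type*} (X : ℕ → Ω → ℝ) (μlo μhi : ℝ) (Z : Ω → ℝ) : Set Ω :=
  {ω | Tendsto (fun n : ℕ => (∑ i ∈ Finset.range n, X i ω) / (n : ℝ)) atTop
    (𝓝 (max μlo (min (Z ω) μhi)))}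

end SubLin

end
/-!
Under the supremum of their expectations, the laws of `X` make the coordinates independent and
identically distributed, with compact sets of moments of cylinder functions and uniformly summable
tails. Call the random variables `s n = σ n (X₁, …, Xₙ)` a control, and the support function of the
interval between the lower and the upper truncated mean its gain. By independence, the upper
expectation of the profits `s n * Xₙ₊₁` minus the gains is zero, so by compactness some law of the
family attains the gain of the control at all times. Under that law the conditional mean of `Xₙ₊₁`
is the upper mean where `s n > 0` and the lower mean where `s n < 0`, and the averages `S_n / n`
follow these conditional means by the strong law for martingale differences.

Now let `τ n` be bounded Lipschitz functions of `X₁, …, Xₙ` that converge to the target, and take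
for `s n` the difference of `τ n` and the running average, clipped to `[-1, 1]`: the drift always
points towards the target, so that `S_n / n` converges to its truncation to `[μlo, μhi]`. For a
target in `𝕃_c`, which after truncation covers the continuous ones, tightness yields such `τ n` for
all laws simultaneously. For a Borel function of `X₁, …, X_d` they depend on the law of
`X₁, …, X_d`; this law is fixed in advance, independently of the control, by requiring that it have
lexicographically maximal moments along a sequence of functions that determines it.
-/

noncomputable section

namespace SubLin

/-! ### Bounded Lipschitz functions -/

/-- Truncation of a real number to `[-c, c]`; `SubLinSpace.trunc c X` is `clip c ∘ X`. -/
def clip (c x : ℝ) : ℝ := max (-c) (min x c)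

theorem abs_clip_le {c : ℝ} (hc : 0 ≤ c) (x : ℝ) : |clip c x| ≤ c :=
  abs_le.2 ⟨le_max_left _ _, max_le (by linarith) (min_le_right _ _)⟩

theorem clip_eq_self {c x : ℝ} (h : |x| ≤ c) : clip c x = x := by
  rw [abs_le] at h
  rw [clip, min_eq_left h.2, max_eq_right h.1]

theorem lipschitzWith_clamp (a b : ℝ) : LipschitzWith 1 (fun x : ℝ => max a (min x b)) :=
  (LipschitzWith.id.min_const b).const_max a

theorem lipschitzWith_clip (c : ℝ) : LipschitzWith 1 (clip c) := lipschitzWith_clamp (-c) c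

theorem continuous_clip (c : ℝ) : Continuous (clip c) := (lipschitzWith_clip c).continuous

theorem clip_neg {c : ℝ} (hc : 0 ≤ c) (x : ℝ) : clip c (-x) = -clip c x := by
  unfold clip
  rcases le_total x (-c) with h | h <;> rcases le_total x c with h' | h' <;>
    simp only [max_def, min_def] <;> split_ifs <;> linarith

theorem abs_clip {c : ℝ} (hc : 0 ≤ c) (x : ℝ) : |clip c x| = min |x| c := by
  rcases le_total |x| c with h | h
  · rw [clip_eq_self h, min_eq_left h]
  · rw [min_eq_right h]
    rcases le_abs.1 h with h' | h'
    · rw [clip, min_eq_right h', max_eq_right (neg_le_self hc), abs_of_nonneg hc]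
    · rw [clip, max_eq_left ((min_le_left _ _).trans (le_neg_of_le_neg h')), abs_neg,
        abs_of_nonneg hc]

namespace BddLip

section Closure

variable {E F : Type*} [PseudoEMetricSpace E] [PseudoEMetricSpace F] {f g : E → ℝ}

theorem continuous (h : BddLip f) : Continuous f := h.1.choose_spec.continuous

theorem const (c : ℝ) : BddLip (fun _ : E => c) :=
  ⟨⟨0, LipschitzWith.const c⟩, |c|, fun _ => le_rfl⟩

theorem add (hf : BddLip f) (hg : BddLip g) : BddLip (fun x => f x + g x) := by
  obtain ⟨⟨K, hK⟩, M, hM⟩ := hf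
  obtain ⟨⟨K', hK'⟩, M', hM'⟩ := hg
  exact ⟨⟨_, hK.add hK'⟩, M + M', fun x => (abs_add_le _ _).trans (add_le_add (hM x) (hM' x))⟩

theorem neg (hf : BddLip f) : BddLip (fun x => -f x) := by
  obtain ⟨⟨K, hK⟩, M, hM⟩ := hf
  exact ⟨⟨_, hK.neg⟩, M, fun x => by rw [abs_neg]; exact hM x⟩

theorem sub (hf : BddLip f) (hg : BddLip g) : BddLip (fun x => f x - g x) := by
  simpa only [sub_eq_add_neg] using hf.add hg.neg

theorem comp {u : F → E} {K : NNReal} (hf : BddLip f) (hu : LipschitzWith K u) :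
    BddLip (fun x => f (u x)) := by
  obtain ⟨⟨L, hL⟩, M, hM⟩ := hf
  exact ⟨⟨_, hL.comp hu⟩, M, fun x => hM _⟩

theorem clamp {K : NNReal} (a b : ℝ) (hf : LipschitzWith K f) :
    BddLip (fun x => max a (min (f x) b)) := by
  refine ⟨⟨_, (lipschitzWith_clamp a b).comp hf⟩, |a| + |b|, fun x => abs_le.2 ⟨?_, ?_⟩⟩
  · linarith [le_max_left a (min (f x) b), neg_abs_le a, abs_nonneg b]
  · refine max_le ?_ ((min_le_right _ _).trans ?_) <;>
      linarith [le_abs_self a, le_abs_self b, abs_nonneg a, abs_nonneg b]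

theorem clip {K : NNReal} (c : ℝ) (hf : LipschitzWith K f) :
    BddLip (fun x => clip c (f x)) := clamp (-c) c hf

end Closure

section Metric

variable {E : Type*} [PseudoMetricSpace E] {f g : E → ℝ}

theorem of_dist_le {K M : ℝ} (h : ∀ x y, |f x - f y| ≤ K * dist x y) (hM : ∀ x, |f x| ≤ M) :
    BddLip f := by
  refine ⟨⟨K.toNNReal, LipschitzWith.of_dist_le_mul fun x y => ?_⟩, M, hM⟩
  rw [Real.dist_eq]
  exact (h x y).trans (mul_le_mul_of_nonneg_right (Real.le_coe_toNNReal K) dist_nonneg)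

theorem exists_bounds (h : BddLip f) :
    ∃ K M : ℝ, 0 ≤ K ∧ 0 ≤ M ∧ (∀ x y, |f x - f y| ≤ K * dist x y) ∧ ∀ x, |f x| ≤ M := by
  obtain ⟨⟨K, hK⟩, M, hM⟩ := h
  refine ⟨K, max M 0, K.2, le_max_right _ _, fun x y => ?_, fun x => (hM x).trans (le_max_left _ _)⟩
  rw [← Real.dist_eq]
  exact hK.dist_le_mul x y

theorem mul (hf : BddLip f) (hg : BddLip g) : BddLip (fun x => f x * g x) := by
  obtain ⟨K, M, -, hM, hfK, hfM⟩ := hf.exists_bounds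
  obtain ⟨K', M', -, hM', hgK, hgM⟩ := hg.exists_bounds
  refine of_dist_le (K := M * K' + M' * K) (M := M * M') (fun x y => ?_) fun x => ?_
  · calc |f x * g x - f y * g y| = |f x * (g x - g y) + g y * (f x - f y)| := by ring_nf
      _ ≤ |f x| * |g x - g y| + |g y| * |f x - f y| := by
        simpa only [abs_mul] using abs_add_le (f x * (g x - g y)) (g y * (f x - f y))
      _ ≤ M * (K' * dist x y) + M' * (K * dist x y) := by
        gcongr
        exacts [hfM x, hgK x y, hgM y, hfK x y]
      _ = (M * K' + M' * K) * dist x y := by ring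
  · rw [abs_mul]
    exact mul_le_mul (hfM x) (hgM x) (abs_nonneg _) hM

theorem const_mul (c : ℝ) (hf : BddLip f) : BddLip (fun x => c * f x) := (const c).mul hf

end Metric

end BddLip

/-! ### Running averages -/

/-- The running average `(x 0 + ⋯ + x (n - 1)) / n`, with the value `0` for `n = 0`. -/
def avg (x : ℕ → ℝ) (n : ℕ) : ℝ := (∑ i ∈ Finset.range n, x i) / n

theorem avg_neg (x : ℕ → ℝ) (n : ℕ) : avg (-x) n = -avg x n := by
  simp only [avg, Pi.neg_apply, Finset.sum_neg_distrib, neg_div]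

theorem avg_add (x y : ℕ → ℝ) (n : ℕ) : avg (x + y) n = avg x n + avg y n := by
  simp only [avg, Pi.add_apply, Finset.sum_add_distrib, add_div]

/-- Kronecker's lemma for the weights `n + 1`. -/
theorem tendsto_avg_of_tendsto_sum_div {ξ : ℕ → ℝ} {s : ℝ}
    (h : Tendsto (fun n => ∑ i ∈ Finset.range n, ξ i / (i + 1)) atTop (𝓝 s)) :
    Tendsto (avg ξ) atTop (𝓝 0) := by
  set u : ℕ → ℝ := fun n => ∑ i ∈ Finset.range n, ξ i / (i + 1) with hu
  have summation_by_parts : ∀ n : ℕ,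
      ∑ i ∈ Finset.range n, ξ i = n * u n - ∑ i ∈ Finset.range n, u i := by
    intro n
    induction n with
    | zero => simp
    | succ n ih =>
      have hsucc : u (n + 1) = u n + ξ n / (n + 1) := by simp only [hu, Finset.sum_range_succ]
      rw [Finset.sum_range_succ, Finset.sum_range_succ, ih, hsucc]
      push_cast
      field_simp
      ring
  have hlim := h.sub h.cesaro
  rw [sub_self] at hlim
  refine hlim.congr' ?_
  filter_upwards [eventually_gt_atTop 0] with n hn
  have hn' : (n : ℝ) ≠ 0 := by positivity
  rw [avg, summation_by_parts]
  field_simp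

theorem exists_le_add_mul_of_barrier {u : ℕ → ℝ} {N : ℕ} {δ B : ℝ} (hδ : 0 ≤ δ)
    (hB : ∀ n, N ≤ n → u (n + 1) ≤ u n + B)
    (hstep : ∀ n, N ≤ n → δ * n < u n → u (n + 1) ≤ u n + δ) :
    ∃ C, ∀ n, N ≤ n → u n ≤ C + δ * n := by
  refine ⟨max (u N) 0 + |B|, fun n hn => ?_⟩
  induction n, hn using Nat.le_induction with
  | base => linarith [le_max_left (u N) 0, abs_nonneg B, mul_nonneg hδ N.cast_nonneg]
  | succ n hn ih =>
    push_cast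
    rcases le_or_gt (u n) (δ * n) with hle | hgt
    · linarith [hB n hn, le_abs_self B, le_max_right (u N) 0]
    · linarith [hstep n hn hgt]

theorem eventually_avg_le_of_drift {x m lo τ : ℕ → ℝ} {L t B : ℝ}
    (hnoise : Tendsto (avg (x - m)) atTop (𝓝 0))
    (hlo : Tendsto lo atTop (𝓝 L)) (hLt : L ≤ t) (hτ : Tendsto τ atTop (𝓝 t))
    (hB : ∀ᶠ n in atTop, m n ≤ B) (hctl : ∀ᶠ n in atTop, τ n < avg x n → m n ≤ lo n)
    {ε : ℝ} (hε : 0 < ε) : ∀ᶠ n in atTop, avg x n ≤ t + ε := by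
  obtain ⟨δ, hδ, rfl⟩ : ∃ δ > 0, ε = 4 * δ := ⟨ε / 4, by positivity, by ring⟩
  have hsmall : ∀ᶠ n in atTop, |avg (x - m) n| < δ := by
    simpa only [Real.dist_eq, sub_zero] using Metric.tendsto_nhds.1 hnoise δ hδ
  obtain ⟨N, hN⟩ := eventually_atTop.1 (hsmall.and
    ((hlo.eventually_lt_const (u := t + δ) (by linarith)).and
      ((hτ.eventually_lt_const (u := t + δ) (by linarith)).and
        (hB.and (hctl.and (eventually_gt_atTop 0))))))
  set u : ℕ → ℝ := fun n => ∑ i ∈ Finset.range n, (m i - t) with hu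
  have hsucc : ∀ n, u (n + 1) = u n + (m n - t) := fun n => Finset.sum_range_succ _ n
  have havg : ∀ n, N ≤ n → avg x n = u n / n + t + avg (x - m) n := by
    intro n hn
    have hn0 : (n : ℝ) ≠ 0 := by have := (hN n hn).2.2.2.2.2; positivity
    simp only [avg, hu, Pi.sub_apply, Finset.sum_sub_distrib, Finset.sum_const, Finset.card_range,
      nsmul_eq_mul]
    field_simp
    ring
  obtain ⟨C, hC⟩ := exists_le_add_mul_of_barrier (u := u) (N := N) (δ := 2 * δ) (B := B - t)
    (by positivity) (fun n hn => by linarith [hsucc n, (hN n hn).2.2.2.1]) fun n hn hgt => by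
      obtain ⟨hnoise_n, hlo_n, hτ_n, -, hctl_n, hn0⟩ := hN n hn
      have hslope : 2 * δ < u n / n := (lt_div_iff₀ (by positivity)).2 hgt
      have := hctl_n (by linarith [havg n hn, (abs_lt.1 hnoise_n).1])
      linarith [hsucc n]
  have hCn : ∀ᶠ n : ℕ in atTop, C / n < δ :=
    (tendsto_const_div_atTop_nhds_zero_nat C).eventually_lt_const hδ
  filter_upwards [hCn, eventually_ge_atTop N] with n hCn hn
  obtain ⟨hnoise_n, -, -, -, -, hn0⟩ := hN n hn
  have hun : u n / n ≤ C / n + 2 * δ := by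
    have : (0 : ℝ) < n := by positivity
    rw [div_le_iff₀ this, add_mul, div_mul_cancel₀ _ this.ne']
    exact hC n hn
  linarith [havg n hn, (abs_lt.1 hnoise_n).2]

theorem tendsto_avg_of_drift {x m lo hi τ : ℕ → ℝ} {L H t : ℝ}
    (hnoise : Tendsto (avg (x - m)) atTop (𝓝 0))
    (hlo : Tendsto lo atTop (𝓝 L)) (hhi : Tendsto hi atTop (𝓝 H)) (hLt : L ≤ t) (htH : t ≤ H)
    (hτ : Tendsto τ atTop (𝓝 t)) (hm : ∀ᶠ n in atTop, m n ∈ Set.Icc (lo n) (hi n))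
    (hup : ∀ᶠ n in atTop, avg x n < τ n → m n = hi n)
    (hdown : ∀ᶠ n in atTop, τ n < avg x n → m n = lo n) :
    Tendsto (avg x) atTop (𝓝 t) := by
  obtain ⟨B, hB⟩ := hhi.bddAbove_range
  obtain ⟨B', hB'⟩ := hlo.bddBelow_range
  have habove : ∀ ε > 0, ∀ᶠ n in atTop, avg x n ≤ t + ε := fun ε hε =>
    eventually_avg_le_of_drift hnoise hlo hLt hτ (hm.mono fun n h => h.2.trans (hB ⟨n, rfl⟩))
      (hdown.mono fun n h h' => (h h').le) hε
  have hbelow : ∀ ε > 0, ∀ᶠ n in atTop, avg (-x) n ≤ -t + ε := fun ε hε =>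
    eventually_avg_le_of_drift (m := -m)
      (by
        rw [neg_sub_neg, ← neg_sub, ← neg_zero]
        exact hnoise.neg.congr fun n => (avg_neg _ n).symm)
      hhi.neg (neg_le_neg htH) hτ.neg
      (hm.mono fun n h => neg_le_neg ((hB' ⟨n, rfl⟩).trans h.1))
      (hup.mono fun n h h' => by
        rw [avg_neg] at h'
        exact neg_le_neg (h (neg_lt_neg_iff.1 h')).ge) hε
  rw [Metric.tendsto_nhds]
  intro ε hε
  filter_upwards [habove (ε / 2) (half_pos hε), hbelow (ε / 2) (half_pos hε)] with n ha hb
  rw [avg_neg] at hb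
  rw [Real.dist_eq, abs_lt]
  constructor <;> linarith

/-! ### Lexicographically maximal points of compact sets -/

section LexMax

theorem exists_lexMax {α : Type*} [LinearOrder α] [TopologicalSpace α] [OrderClosedTopology α]
    {C : Set (ℕ → α)} (hC : IsCompact C) (hne : C.Nonempty) :
    ∃ p ∈ C, ∀ j, ∀ x ∈ C, (∀ i < j, x i = p i) → x j ≤ p j := by
  let K : ℕ → Set (ℕ → α) := fun n => Nat.rec C (fun j A => {x ∈ A | ∀ y ∈ A, y j ≤ x j}) n
  have mem_succ : ∀ {j x}, x ∈ K (j + 1) ↔ x ∈ K j ∧ ∀ y ∈ K j, y j ≤ x j := Iff.rfl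
  have compact_nonempty : ∀ j, IsCompact (K j) ∧ (K j).Nonempty := by
    intro j
    induction j with
    | zero => exact ⟨hC, hne⟩
    | succ j ih =>
      obtain ⟨z, hz, hmax⟩ := ih.1.exists_isMaxOn ih.2 (continuous_apply j).continuousOn
      have hK : K (j + 1) = K j ∩ {x | z j ≤ x j} := Set.ext fun x =>
        ⟨fun h => ⟨h.1, h.2 z hz⟩, fun h => ⟨h.1, fun y hy => (hmax hy).trans h.2⟩⟩
      rw [hK]
      exact ⟨ih.1.inter_right (isClosed_le continuous_const (continuous_apply j)), z, hz, le_rfl⟩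
  obtain ⟨p, hp⟩ := IsCompact.nonempty_iInter_of_sequence_nonempty_isCompact_isClosed K
    (fun j _ hx => hx.1) (fun j => (compact_nonempty j).2) (compact_nonempty 0).1
    (fun j => (compact_nonempty j).1.isClosed)
  rw [Set.mem_iInter] at hp
  refine ⟨p, hp 0, fun j x hx hxp => ?_⟩
  have hmem : ∀ i ≤ j, x ∈ K i := by
    intro i
    induction i with
    | zero => exact fun _ => hx
    | succ i ih =>
      exact fun hij => ⟨ih (by omega), fun y hy => hxp i hij ▸ (mem_succ.1 (hp (i + 1))).2 y hy⟩
  exact (mem_succ.1 (hp (j + 1))).2 x (hmem j le_rfl)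

variable {E : Type*} [TopologicalSpace E] [T2Space E] {C : Set E}

theorem exists_eq_zero_of_penalty (hC : IsCompact C) {f : E → ℝ} {h : ℕ → E → ℝ}
    (hf : Continuous f) (hh : ∀ N, Continuous (h N)) (h0 : ∀ N, ∀ x ∈ C, 0 ≤ h N x)
    (hmono : ∀ x ∈ C, Monotone fun N => h N x) {s : ℝ}
    (hs : ∀ N : ℕ, ∃ x ∈ C, s ≤ f x - N * h N x) :
    ∃ x ∈ C, s ≤ f x ∧ ∀ N, h N x = 0 := by
  set K : ℕ → Set E := fun N => C ∩ {x | s ≤ f x - N * h N x}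
  have hKc : ∀ N, IsCompact (K N) := fun N =>
    hC.inter_right (isClosed_le continuous_const (hf.sub (continuous_const.mul (hh N))))
  have hKanti : ∀ N, K (N + 1) ⊆ K N := by
    rintro N x ⟨hxC, hx⟩
    refine ⟨hxC, le_trans (Set.mem_ofPred_eq ▸ hx) (sub_le_sub_left ?_ _)⟩
    exact mul_le_mul (Nat.cast_le.2 N.le_succ) (hmono x hxC N.le_succ) (h0 N x hxC) (by positivity)
  obtain ⟨x, hx⟩ := IsCompact.nonempty_iInter_of_sequence_nonempty_isCompact_isClosed K hKanti hs
    (hKc 0) (fun N => (hKc N).isClosed)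
  rw [Set.mem_iInter] at hx
  have hxC : x ∈ C := (hx 0).1
  have hxs : ∀ N : ℕ, s ≤ f x - N * h N x := fun N => (hx N).2
  refine ⟨x, hxC, by simpa using hxs 0, fun N => (h0 N x hxC).antisymm' (not_lt.1 fun hpos => ?_)⟩
  obtain ⟨n, hn⟩ := exists_nat_gt ((f x - s) / h N x)
  rw [div_lt_iff₀ hpos] at hn
  have hbound : (n : ℝ) * h N x ≤ (max n N : ℕ) * h (max n N) x :=
    mul_le_mul (Nat.cast_le.2 (le_max_left n N)) (hmono x hxC (le_max_right n N)) hpos.le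
      (Nat.cast_nonneg _)
  linarith [hxs (max n N)]

/-- A lexicographically maximal value `p` of `g` on `K` is attained as soon as it lies in the closed
convex hull of the values of `g`, which `hsupp` expresses through support functions. -/
theorem exists_forall_eq_of_lexMax {K : Set E} (hK : IsCompact K) {g : ℕ → E → ℝ}
    (hg : ∀ i, Continuous (g i)) {p : ℕ → ℝ}
    (hp : ∀ j, ∀ x ∈ K, (∀ i < j, g i x = p i) → g j x ≤ p j)
    (hsupp : ∀ a : ℕ →₀ ℝ, ∃ x ∈ K, (a.sum fun i r => r * p i) ≤ a.sum fun i r => r * g i x) :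
    ∃ x ∈ K, ∀ i, g i x = p i := by
  let A : ℕ → Set E := fun J => K ∩ {x | ∀ i < J, g i x = p i}
  have hA : ∀ J, IsCompact (A J) := fun J => by
    simp only [A, Set.ofPred_forall]
    exact hK.inter_right (isClosed_iInter fun i => isClosed_iInter fun _ =>
      isClosed_eq (hg i) continuous_const)
  have supp_face : ∀ J, ∀ a : ℕ →₀ ℝ, ∃ x ∈ A J,
      (a.sum fun i r => r * p i) ≤ a.sum fun i r => r * g i x := by
    intro J
    induction J with
    | zero =>
      intro a
      obtain ⟨x, hx, h⟩ := hsupp a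
      exact ⟨x, ⟨hx, fun i hi => absurd hi i.not_lt_zero⟩, h⟩
    | succ J ih =>
      intro a
      obtain ⟨x, hx, hax, hJ⟩ := exists_eq_zero_of_penalty (hA J)
        (f := fun x => a.sum fun i r => r * g i x) (h := fun _ x => p J - g J x)
        (s := a.sum fun i r => r * p i)
        (continuous_finsetSum _ fun i _ => continuous_const.mul (hg i))
        (fun _ => continuous_const.sub (hg J)) (fun _ x hx => sub_nonneg.2 (hp J x hx.1 hx.2))
        (fun _ _ => monotone_const) (fun N => by
          obtain ⟨x, hx, h⟩ := ih (a + Finsupp.single J (N : ℝ))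
          rw [Finsupp.sum_add_index' (by simp) (by intros; ring),
            Finsupp.sum_add_index' (by simp) (by intros; ring),
            Finsupp.sum_single_index (by simp), Finsupp.sum_single_index (by simp)] at h
          exact ⟨x, hx, by linarith⟩)
      refine ⟨x, ⟨hx.1, fun i hi => ?_⟩, hax⟩
      rcases Nat.lt_succ_iff_lt_or_eq.1 hi with h | rfl
      · exact hx.2 i h
      · exact (sub_eq_zero.1 (hJ 0)).symm
  obtain ⟨x, hx⟩ := IsCompact.nonempty_iInter_of_sequence_nonempty_isCompact_isClosed A
    (fun J x hx => ⟨hx.1, fun i hi => hx.2 i (Nat.lt_succ_of_lt hi)⟩)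
    (fun J => let ⟨x, hx, _⟩ := supp_face J 0; ⟨x, hx⟩) (hA 0) (fun J => (hA J).isClosed)
  rw [Set.mem_iInter] at hx
  exact ⟨x, (hx 0).1, fun i => (hx (i + 1)).2 i i.lt_succ_self⟩

theorem exists_forall_eq_of_penalty (hC : IsCompact C) {g h : ℕ → E → ℝ}
    (hg : ∀ i, Continuous (g i)) (hh : ∀ n, Continuous (h n)) (h0 : ∀ n, ∀ x ∈ C, 0 ≤ h n x)
    {p : ℕ → ℝ} (hp : ∀ j, ∀ x ∈ C, (∀ i < j, g i x = p i) → g j x ≤ p j)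
    (hsupp : ∀ (a : ℕ →₀ ℝ) (N : ℕ), ∃ x ∈ C, (a.sum fun i r => r * p i) ≤
      (a.sum fun i r => r * g i x) - N * ∑ n ∈ Finset.range N, h n x) :
    ∃ x ∈ C, (∀ i, g i x = p i) ∧ ∀ n, h n x = 0 := by
  have hK : IsCompact (C ∩ ⋂ n, {x | h n x = 0}) :=
    hC.inter_right (isClosed_iInter fun n => isClosed_eq (hh n) continuous_const)
  obtain ⟨x, ⟨hxC, hx0⟩, hx⟩ := exists_forall_eq_of_lexMax hK hg (fun j x hx => hp j x hx.1)
    fun a => by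
      obtain ⟨x, hx, hax, hzero⟩ := exists_eq_zero_of_penalty hC
        (f := fun x => a.sum fun i r => r * g i x) (h := fun N x => ∑ n ∈ Finset.range N, h n x)
        (continuous_finsetSum _ fun i _ => continuous_const.mul (hg i))
        (fun N => continuous_finsetSum _ fun n _ => hh n)
        (fun N x hx => Finset.sum_nonneg fun n _ => h0 n x hx)
        (fun x hx => monotone_nat_of_le_succ fun N => by
          rw [Finset.sum_range_succ]; linarith [h0 N x hx]) (hsupp a)
      refine ⟨x, ⟨hx, Set.mem_iInter.2 fun n => Set.mem_ofPred_eq ▸ ?_⟩, hax⟩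
      simpa only [Finset.sum_range_succ, hzero n, zero_add] using hzero (n + 1)
  exact ⟨x, hxC, hx, fun n => Set.mem_iInter.1 hx0 n⟩

end LexMax

/-! ### Lipschitz regularisation -/

section Regularisation

variable {E : Type*} [PseudoMetricSpace E] {f : E → ℝ} {m : ℝ}

/-- The largest `k`-Lipschitz minorant of `f` (the Pasch–Hausdorff envelope); the infimum is the
intended one for `f` bounded below. -/
def lipLower (f : E → ℝ) (k : ℕ) (x : E) : ℝ := ⨅ y, (f y + k * dist x y)

theorem le_add_mul_dist (hm : ∀ x, m ≤ f x) (k : ℕ) (x y : E) : m ≤ f y + k * dist x y :=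
  le_add_of_le_of_nonneg (hm y) (by positivity)

theorem lipLower_le_add (hm : ∀ x, m ≤ f x) (k : ℕ) (x y : E) :
    lipLower f k x ≤ f y + k * dist x y :=
  ciInf_le ⟨m, Set.forall_mem_range.2 (le_add_mul_dist hm k x)⟩ y

theorem lipLower_le (hm : ∀ x, m ≤ f x) (k : ℕ) (x : E) : lipLower f k x ≤ f x := by
  simpa only [dist_self, mul_zero, add_zero] using lipLower_le_add hm k x x

theorem le_lipLower (hm : ∀ x, m ≤ f x) (k : ℕ) (x : E) : m ≤ lipLower f k x :=
  have : Nonempty E := ⟨x⟩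
  le_ciInf (le_add_mul_dist hm k x)

theorem lipschitzWith_lipLower (hm : ∀ x, m ≤ f x) (k : ℕ) : LipschitzWith k (lipLower f k) := by
  refine LipschitzWith.of_le_add_mul _ fun x y => ?_
  have : Nonempty E := ⟨x⟩
  rw [← sub_le_iff_le_add]
  refine le_ciInf fun z => ?_
  have htri : (k : ℝ) * dist x z ≤ k * dist x y + k * dist y z := by
    rw [← mul_add]
    gcongr
    exact dist_triangle _ _ _
  push_cast
  linarith [lipLower_le_add hm k x z]

theorem lipLower_mono (hm : ∀ x, m ≤ f x) {k l : ℕ} (hkl : k ≤ l) (x : E) :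
    lipLower f k x ≤ lipLower f l x :=
  ciInf_mono ⟨m, Set.forall_mem_range.2 (le_add_mul_dist hm k x)⟩ fun y => by gcongr

theorem tendsto_lipLower (hm : ∀ x, m ≤ f x) {x : E} (hf : ContinuousAt f x) :
    Tendsto (fun k => lipLower f k x) atTop (𝓝 (f x)) := by
  have : Nonempty E := ⟨x⟩
  refine tendsto_order.2 ⟨fun a ha => ?_, fun a ha =>
    Eventually.of_forall fun k => (lipLower_le hm k x).trans_lt ha⟩
  obtain ⟨b, hab, hb⟩ := exists_between ha
  obtain ⟨δ, hδ, hball⟩ := Metric.eventually_nhds_iff.1 (hf.eventually_const_lt hb)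
  obtain ⟨K, hK⟩ := exists_nat_gt ((b - m) / δ)
  rw [div_lt_iff₀ hδ] at hK
  filter_upwards [eventually_ge_atTop K] with k hk
  refine hab.trans_le (le_ciInf fun y => ?_)
  rcases lt_or_ge (dist y x) δ with hnear | hfar
  · exact (hball hnear).le.trans (le_add_of_nonneg_right (by positivity))
  · have : (K : ℝ) * δ ≤ k * dist x y := by
      rw [dist_comm]
      gcongr
    linarith [hm y]

theorem bddLip_lipLower {M : ℝ} (hM : ∀ x, |f x| ≤ M) (k : ℕ) : BddLip (lipLower f k) :=
  have hm : ∀ x, -M ≤ f x := fun x => (abs_le.1 (hM x)).1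
  ⟨⟨_, lipschitzWith_lipLower hm k⟩, M, fun x =>
    abs_le.2 ⟨le_lipLower hm k x, (lipLower_le hm k x).trans (abs_le.1 (hM x)).2⟩⟩

end Regularisation

section Approximation

theorem ae_tendsto_of_tsum_lintegral_edist {α E : Type*} [MeasurableSpace α] {μ : Measure α}
    [PseudoEMetricSpace E] {g : ℕ → α → E} {φ : α → E}
    (hm : ∀ k, AEMeasurable (fun x => edist (g k x) (φ x)) μ)
    (h : ∑' k, ∫⁻ x, edist (g k x) (φ x) ∂μ ≠ ∞) :
    ∀ᵐ x ∂μ, Tendsto (fun k => g k x) atTop (𝓝 (φ x)) := by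
  rw [← lintegral_tsum hm] at h
  filter_upwards [ae_lt_top' (AEMeasurable.tsum hm) h] with x hx
  exact tendsto_iff_edist_tendsto_0.2 (ENNReal.tendsto_atTop_zero_of_tsum_ne_top hx.ne)

variable {E : Type*} [PseudoMetricSpace E] [MeasurableSpace E] [BorelSpace E]

theorem tendsto_lintegral_edist_lipLower (μ : Measure E) [IsFiniteMeasure μ] (f : E →ᵇ ℝ) :
    Tendsto (fun k => ∫⁻ x, edist (lipLower f k x) (f x) ∂μ) atTop (𝓝 0) := by
  have hf : ∀ x, |f x| ≤ ‖f‖ := f.norm_coe_le_norm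
  have hm : ∀ x, -‖f‖ ≤ f x := fun x => (abs_le.1 (hf x)).1
  rw [← lintegral_zero (μ := μ)]
  refine tendsto_lintegral_of_dominated_convergence (fun _ => ENNReal.ofReal (2 * ‖f‖))
    (fun k => (bddLip_lipLower hf k).continuous.measurable.edist f.continuous.measurable)
    (fun k => Eventually.of_forall fun x => ?_)
    (by rw [lintegral_const]; exact ENNReal.mul_ne_top ENNReal.ofReal_ne_top (measure_ne_top _ _))
    (Eventually.of_forall fun x =>
      tendsto_iff_edist_tendsto_0.1 (tendsto_lipLower hm f.continuous.continuousAt))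
  dsimp only
  rw [edist_dist, Real.dist_eq, abs_sub_comm, abs_of_nonneg (sub_nonneg.2 (lipLower_le hm k x))]
  exact ENNReal.ofReal_le_ofReal (by linarith [le_lipLower hm k x, (abs_le.1 (hf x)).2])

theorem exists_bddLip_lintegral_edist_le (μ : Measure E) [IsFiniteMeasure μ] {φ : E → ℝ}
    (hφ : Integrable φ μ) {ε : ℝ≥0∞} (hε : ε ≠ 0) :
    ∃ g : E → ℝ, BddLip g ∧ ∫⁻ x, edist (g x) (φ x) ∂μ ≤ ε := by
  have hε2 : ε / 2 ≠ 0 := (ENNReal.half_pos hε).ne'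
  obtain ⟨f, hf, -⟩ := (memLp_one_iff_integrable.2 hφ).exists_boundedContinuous_eLpNorm_sub_le
    ENNReal.one_ne_top hε2
  obtain ⟨k, hk⟩ := ((tendsto_lintegral_edist_lipLower μ f).eventually_lt_const
    (pos_iff_ne_zero.2 hε2)).exists
  have hlip := bddLip_lipLower f.norm_coe_le_norm k
  refine ⟨lipLower f k, hlip, ?_⟩
  calc ∫⁻ x, edist (lipLower f k x) (φ x) ∂μ
      ≤ ∫⁻ x, edist (lipLower f k x) (f x) ∂μ + ∫⁻ x, edist (φ x) (f x) ∂μ :=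
        lintegral_edist_triangle hlip.continuous.aestronglyMeasurable
          f.continuous.aestronglyMeasurable
    _ ≤ ε / 2 + ε / 2 := by
        refine add_le_add hk.le (le_trans (le_of_eq ?_) hf)
        simp only [eLpNorm_one_eq_lintegral_enorm, Pi.sub_apply, edist_eq_enorm_sub]
    _ = ε := ENNReal.add_halves ε

theorem exists_bddLip_tendsto_ae (μ : Measure E) [IsFiniteMeasure μ] {φ : E → ℝ}
    (hφ : Integrable φ μ) :
    ∃ g : ℕ → E → ℝ, (∀ k, BddLip (g k)) ∧
      ∀ᵐ x ∂μ, Tendsto (fun k => g k x) atTop (𝓝 (φ x)) := by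
  choose g hg hgφ using fun k : ℕ =>
    exists_bddLip_lintegral_edist_le μ hφ (pow_ne_zero k (by simp) : (2⁻¹ : ℝ≥0∞) ^ k ≠ 0)
  refine ⟨g, hg, ae_tendsto_of_tsum_lintegral_edist
    (fun k => (hg k).continuous.measurable.aemeasurable.edist hφ.aemeasurable) ?_⟩
  refine ne_top_of_le_ne_top ?_ (ENNReal.tsum_le_tsum hgφ)
  rw [ENNReal.tsum_geometric]
  simp

end Approximation

/-! ### Conditional expectations -/

section CondExp

variable {Ω : Type*} {m m₀ : MeasurableSpace Ω} {μ : Measure Ω} {f g : Ω → ℝ}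

theorem integral_mul_condExp (hm : m ≤ m₀) [SigmaFinite (μ.trim hm)]
    (hg : StronglyMeasurable[m] g) (hgf : Integrable (g * f) μ) (hf : Integrable f μ) :
    ∫ ω, g ω * (μ[f | m]) ω ∂μ = ∫ ω, g ω * f ω ∂μ :=
  (integral_congr_ae (condExp_mul_of_stronglyMeasurable_left hg hgf hf).symm).trans
    (integral_condExp hm)

theorem condExp_ae_le_of_forall_setIntegral_le (hm : m ≤ m₀) [SigmaFinite (μ.trim hm)]
    (hf : Integrable f μ) (hg : Integrable g μ)
    (h : ∀ s, MeasurableSet[m] s → ∫ ω in s, f ω ∂μ ≤ ∫ ω in s, g ω ∂μ) :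
    μ[f | m] ≤ᵐ[μ] μ[g | m] := by
  refine ae_le_of_ae_le_trim (hm := hm) (ae_le_of_forall_setIntegral_le
    (integrable_condExp.trim hm stronglyMeasurable_condExp)
    (integrable_condExp.trim hm stronglyMeasurable_condExp) fun s hs _ => ?_)
  rw [← setIntegral_trim hm stronglyMeasurable_condExp hs,
    ← setIntegral_trim hm stronglyMeasurable_condExp hs, setIntegral_condExp hm hf hs,
    setIntegral_condExp hm hg hs]
  exact h s hs

theorem integral_sub_condExp_sq_le (hm : m ≤ m₀) [IsFiniteMeasure μ] (hf : MemLp f 2 μ) :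
    ∫ ω, (f ω - (μ[f | m]) ω) ^ 2 ∂μ ≤ ∫ ω, f ω ^ 2 ∂μ := by
  calc ∫ ω, (f ω - (μ[f | m]) ω) ^ 2 ∂μ = ∫ ω, (ProbabilityTheory.condVar m f μ) ω ∂μ :=
        (integral_condExp hm).symm
    _ ≤ ∫ ω, (μ[f ^ 2 | m]) ω ∂μ :=
        integral_mono_ae ProbabilityTheory.integrable_condVar integrable_condExp
          (ProbabilityTheory.condVar_ae_le_condExp_sq hm hf)
    _ = ∫ ω, f ω ^ 2 ∂μ := integral_condExp hm

section Comap

variable {E : Type*} [PseudoMetricSpace E] [MeasurableSpace E] [BorelSpace E] {Y : Ω → E}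

theorem setIntegral_preimage_nonpos [IsFiniteMeasure μ] (hY : Measurable Y) (hf : Integrable f μ)
    (h : ∀ g : E → ℝ, BddLip g → (∀ y, 0 ≤ g y) → ∫ ω, g (Y ω) * f ω ∂μ ≤ 0)
    {A : Set E} (hA : MeasurableSet A) : ∫ ω in Y ⁻¹' A, f ω ∂μ ≤ 0 := by
  set φ : E → ℝ := A.indicator 1 with hφ
  obtain ⟨g, hg, hgφ⟩ := exists_bddLip_tendsto_ae (μ.map Y)
    ((integrable_const (1 : ℝ)).indicator hA : Integrable φ (μ.map Y))
  set G : ℕ → E → ℝ := fun k y => max 0 (min (g k y) 1)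
  have hG01 : ∀ k y, G k y ∈ Set.Icc (0 : ℝ) 1 := fun k y =>
    ⟨le_max_left _ _, max_le zero_le_one (min_le_right _ _)⟩
  have hGlip : ∀ k, BddLip (G k) := fun k => BddLip.clamp 0 1 (hg k).1.choose_spec
  have hGφ : ∀ᵐ ω ∂μ, Tendsto (fun k => G k (Y ω)) atTop (𝓝 (φ (Y ω))) := by
    filter_upwards [ae_of_ae_map hY.aemeasurable hgφ] with ω hω
    have hclamp : φ (Y ω) = max 0 (min (φ (Y ω)) 1) := by
      by_cases hω' : Y ω ∈ A <;> simp [hφ, hω']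
    rw [hclamp]
    exact ((lipschitzWith_clamp 0 1).continuous.tendsto _).comp hω
  have hlim : Tendsto (fun k => ∫ ω, G k (Y ω) * f ω ∂μ) atTop (𝓝 (∫ ω, φ (Y ω) * f ω ∂μ)) := by
    refine tendsto_integral_of_dominated_convergence (fun ω => |f ω|)
      (fun k => ((hGlip k).continuous.measurable.comp hY).aestronglyMeasurable.mul hf.1) hf.abs
      (fun k => Eventually.of_forall fun ω => ?_) (hGφ.mono fun ω hω => hω.mul_const _)
    rw [Real.norm_eq_abs, abs_mul, abs_of_nonneg (hG01 k _).1]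
    exact mul_le_of_le_one_left (abs_nonneg _) (hG01 k _).2
  have hind : (Y ⁻¹' A).indicator f = fun ω => φ (Y ω) * f ω := by
    ext ω
    by_cases hω : Y ω ∈ A <;> simp [hφ, Set.indicator, hω]
  rw [← integral_indicator (hY hA), hind]
  exact le_of_tendsto' hlim fun k => h (G k) (hGlip k) fun y => (hG01 k y).1

theorem condExp_comap_ae_le [IsFiniteMeasure μ] (hY : Measurable Y) (hf : Integrable f μ)
    (hg : Integrable g μ)
    (h : ∀ u : E → ℝ, BddLip u → (∀ y, 0 ≤ u y) → ∫ ω, u (Y ω) * (f ω - g ω) ∂μ ≤ 0) :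
    μ[f | MeasurableSpace.comap Y inferInstance] ≤ᵐ[μ]
      μ[g | MeasurableSpace.comap Y inferInstance] := by
  refine condExp_ae_le_of_forall_setIntegral_le hY.comap_le hf hg ?_
  rintro _ ⟨A, hA, rfl⟩
  rw [← sub_nonpos, ← integral_sub hf.integrableOn hg.integrableOn]
  exact setIntegral_preimage_nonpos hY (hf.sub hg) h hA

end Comap

end CondExp

/-! ### The strong law for martingale differences -/

section Martingale

variable {Ω : Type*} {m₀ : MeasurableSpace Ω} {μ : Measure Ω} [IsFiniteMeasure μ]
  {ℱ : Filtration ℕ m₀} {D : ℕ → Ω → ℝ}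

theorem stronglyAdapted_sum_range (hD : ∀ n, StronglyMeasurable[ℱ (n + 1)] (D n)) :
    StronglyAdapted ℱ fun n ω => ∑ i ∈ Finset.range n, D i ω := fun _ =>
  Finset.stronglyMeasurable_fun_sum _ fun i hi =>
    (hD i).mono (ℱ.mono (Nat.succ_le_of_lt (Finset.mem_range.1 hi)))

theorem martingale_sum_range (hD : ∀ n, StronglyMeasurable[ℱ (n + 1)] (D n))
    (hint : ∀ n, Integrable (D n) μ) (h0 : ∀ n, μ[D n | ℱ n] =ᵐ[μ] 0) :
    Martingale (fun n ω => ∑ i ∈ Finset.range n, D i ω) ℱ μ := by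
  refine martingale_of_condExp_sub_eq_zero_nat (stronglyAdapted_sum_range hD)
    (fun n => integrable_finsetSum _ fun i _ => hint i) fun n => ?_
  have hsucc : (fun ω => ∑ i ∈ Finset.range (n + 1), D i ω)
      - (fun ω => ∑ i ∈ Finset.range n, D i ω) = D n := by
    ext ω
    rw [Pi.sub_apply, Finset.sum_range_succ, add_sub_cancel_left]
  rw [hsucc]
  exact h0 n

theorem integral_sum_range_sq (hD : ∀ n, StronglyMeasurable[ℱ (n + 1)] (D n))
    (hD2 : ∀ n, MemLp (D n) 2 μ) (h0 : ∀ n, μ[D n | ℱ n] =ᵐ[μ] 0) (n : ℕ) :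
    ∫ ω, (∑ i ∈ Finset.range n, D i ω) ^ 2 ∂μ = ∑ i ∈ Finset.range n, ∫ ω, D i ω ^ 2 ∂μ := by
  induction n with
  | zero => simp
  | succ n ih =>
    set f : Ω → ℝ := fun ω => ∑ i ∈ Finset.range n, D i ω with hf
    have hf2 : MemLp f 2 μ := memLp_finsetSum _ fun i _ => hD2 i
    have hfD : Integrable (fun ω => f ω * D n ω) μ := hf2.integrable_mul (hD2 n)
    have hcross : Integrable (fun ω => f ω ^ 2 + 2 * (f ω * D n ω)) μ :=
      hf2.integrable_sq.add (hfD.const_mul 2)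
    have orthogonal : ∫ ω, f ω * D n ω ∂μ = 0 := by
      rw [← integral_mul_condExp (ℱ.le n) (stronglyAdapted_sum_range hD n) hfD
        ((hD2 n).integrable one_le_two)]
      refine integral_eq_zero_of_ae ((h0 n).mono fun ω hω => ?_)
      simp only [hω, Pi.zero_apply, mul_zero]
    calc ∫ ω, (∑ i ∈ Finset.range (n + 1), D i ω) ^ 2 ∂μ
        = ∫ ω, (f ω ^ 2 + 2 * (f ω * D n ω) + D n ω ^ 2) ∂μ := by
          refine integral_congr_ae (Eventually.of_forall fun ω => ?_)
          simp only [Finset.sum_range_succ, hf]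
          ring
      _ = ∫ ω, f ω ^ 2 ∂μ + 2 * ∫ ω, f ω * D n ω ∂μ + ∫ ω, D n ω ^ 2 ∂μ := by
          rw [integral_add hcross (hD2 n).integrable_sq,
            integral_add hf2.integrable_sq (hfD.const_mul 2), integral_const_mul]
      _ = ∑ i ∈ Finset.range (n + 1), ∫ ω, D i ω ^ 2 ∂μ := by
          rw [orthogonal, mul_zero, add_zero, ih, Finset.sum_range_succ]

theorem integral_abs_le_integral_sq_add {f : Ω → ℝ} (hf : MemLp f 2 μ) :
    ∫ ω, |f ω| ∂μ ≤ ∫ ω, f ω ^ 2 ∂μ + μ.real Set.univ := by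
  calc ∫ ω, |f ω| ∂μ ≤ ∫ ω, (f ω ^ 2 + 1) ∂μ := by
        refine integral_mono (hf.integrable one_le_two).abs
          (hf.integrable_sq.add (integrable_const 1)) fun ω => ?_
        nlinarith [sq_abs (f ω), sq_nonneg (|f ω| - 1)]
    _ = ∫ ω, f ω ^ 2 ∂μ + μ.real Set.univ := by
        rw [integral_add hf.integrable_sq (integrable_const 1), integral_const, smul_eq_mul,
          mul_one]

theorem ae_exists_tendsto_sum_range (hD : ∀ n, StronglyMeasurable[ℱ (n + 1)] (D n))
    (hD2 : ∀ n, MemLp (D n) 2 μ) (h0 : ∀ n, μ[D n | ℱ n] =ᵐ[μ] 0)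
    (hsum : Summable fun n => ∫ ω, D n ω ^ 2 ∂μ) :
    ∀ᵐ ω ∂μ, ∃ s, Tendsto (fun n => ∑ i ∈ Finset.range n, D i ω) atTop (𝓝 s) := by
  have hf2 : ∀ n, MemLp (fun ω => ∑ i ∈ Finset.range n, D i ω) 2 μ := fun n =>
    memLp_finsetSum _ fun i _ => hD2 i
  have hbdd : ∀ n, eLpNorm (fun ω => ∑ i ∈ Finset.range n, D i ω) 1 μ ≤
      ((∑' n, ∫ ω, D n ω ^ 2 ∂μ) + μ.real Set.univ).toNNReal := by
    intro n
    rw [eLpNorm_one_eq_lintegral_enorm,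
      ← ofReal_integral_norm_eq_lintegral_enorm ((hf2 n).integrable one_le_two)]
    refine ENNReal.ofReal_le_ofReal ((integral_abs_le_integral_sq_add (hf2 n)).trans ?_)
    rw [integral_sum_range_sq hD hD2 h0]
    gcongr
    exact hsum.sum_le_tsum _ fun i _ => integral_nonneg fun ω => sq_nonneg _
  have hmart := martingale_sum_range hD (fun n => (hD2 n).integrable one_le_two) h0
  filter_upwards [hmart.submartingale.ae_tendsto_limitProcess hbdd] with ω hω
  exact ⟨_, hω⟩

theorem ae_tendsto_avg_sub_condExp {T : ℕ → Ω → ℝ}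
    (hT : ∀ n, StronglyMeasurable[ℱ (n + 1)] (T n)) (hT2 : ∀ n, MemLp (T n) 2 μ)
    (hsum : Summable fun n : ℕ => (∫ ω, T n ω ^ 2 ∂μ) / ((n : ℝ) + 1) ^ 2) :
    ∀ᵐ ω ∂μ, Tendsto (avg fun i => T i ω - (μ[T i | ℱ i]) ω) atTop (𝓝 0) := by
  set D : ℕ → Ω → ℝ := fun n => ((n : ℝ) + 1)⁻¹ • (T n - μ[T n | ℱ n]) with hD
  have hDm : ∀ n, StronglyMeasurable[ℱ (n + 1)] (D n) := fun n =>
    ((hT n).sub (stronglyMeasurable_condExp.mono (ℱ.mono n.le_succ))).const_smul _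
  have hD2 : ∀ n, MemLp (D n) 2 μ := fun n =>
    ((hT2 n).sub ((hT2 n).condExp one_le_two)).const_smul _
  have hD0 : ∀ n, μ[D n | ℱ n] =ᵐ[μ] 0 := by
    intro n
    filter_upwards [condExp_smul (μ := μ) ((n : ℝ) + 1)⁻¹ (T n - μ[T n | ℱ n]) (ℱ n),
      condExp_sub ((hT2 n).integrable one_le_two) integrable_condExp (ℱ n)] with ω hsmul hsub
    rw [hsmul, Pi.smul_apply, hsub, condExp_of_stronglyMeasurable (ℱ.le n)
      stronglyMeasurable_condExp integrable_condExp, sub_self, Pi.zero_apply, smul_zero]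
  have hDsq : ∀ n, ∫ ω, D n ω ^ 2 ∂μ ≤ (∫ ω, T n ω ^ 2 ∂μ) / ((n : ℝ) + 1) ^ 2 := by
    intro n
    have hsq : ∀ ω, D n ω ^ 2 = (T n ω - (μ[T n | ℱ n]) ω) ^ 2 / ((n : ℝ) + 1) ^ 2 := fun ω => by
      rw [← div_pow, div_eq_inv_mul]
      rfl
    simp only [hsq, integral_div]
    exact div_le_div_of_nonneg_right (integral_sub_condExp_sq_le (ℱ.le n) (hT2 n)) (sq_nonneg _)
  filter_upwards [ae_exists_tendsto_sum_range hDm hD2 hD0 (hsum.of_nonneg_of_le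
    (fun n => integral_nonneg fun ω => sq_nonneg _) hDsq)] with ω ⟨s, hs⟩
  refine tendsto_avg_of_tendsto_sum_div (s := s) (hs.congr fun n => Finset.sum_congr rfl ?_)
  intro i _
  simp only [hD, Pi.smul_apply, Pi.sub_apply, smul_eq_mul, div_eq_inv_mul]

end Martingale

/-! ### The drift of an optimally controlled sequence -/

/-- The support function `s ↦ sup {s * m | m ∈ [lo, hi]}` of the interval `[lo, hi]`: the largest
conditional mean that a control `s` can extract from an increment with mean in `[lo, hi]`. -/
def gain (lo hi s : ℝ) : ℝ := max (s * lo) (s * hi)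

section Gain

variable {lo hi m s : ℝ}

theorem gain_of_nonneg (h : lo ≤ hi) (hs : 0 ≤ s) : gain lo hi s = s * hi :=
  max_eq_right (mul_le_mul_of_nonneg_left h hs)

theorem gain_of_nonpos (h : lo ≤ hi) (hs : s ≤ 0) : gain lo hi s = s * lo :=
  max_eq_left (mul_le_mul_of_nonpos_left h hs)

theorem mul_le_gain (hm : m ∈ Set.Icc lo hi) (s : ℝ) : s * m ≤ gain lo hi s := by
  rcases le_total 0 s with hs | hs
  · exact (mul_le_mul_of_nonneg_left hm.2 hs).trans (le_max_right _ _)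
  · exact (mul_le_mul_of_nonpos_left hm.1 hs).trans (le_max_left _ _)

theorem eq_right_of_gain_eq_mul (hm : m ∈ Set.Icc lo hi) (h : gain lo hi s = s * m) (hs : 0 < s) :
    m = hi :=
  (mul_left_cancel₀ hs.ne' ((gain_of_nonneg (hm.1.trans hm.2) hs.le).symm.trans h)).symm

theorem eq_left_of_gain_eq_mul (hm : m ∈ Set.Icc lo hi) (h : gain lo hi s = s * m) (hs : s < 0) :
    m = lo :=
  (mul_left_cancel₀ hs.ne ((gain_of_nonpos (hm.1.trans hm.2) hs.le).symm.trans h)).symm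

theorem gain_mul {k : ℝ} (hk : 0 ≤ k) (lo hi s : ℝ) : gain lo hi (k * s) = k * gain lo hi s := by
  simp only [gain, mul_max_of_nonneg _ _ hk, mul_assoc]

theorem BddLip.gain {E : Type*} [PseudoMetricSpace E] {s : E → ℝ} (lo hi : ℝ) (hs : BddLip s) :
    BddLip fun x => gain lo hi (s x) := by
  obtain ⟨⟨_, hlo⟩, M, hM⟩ := hs.mul (.const lo)
  obtain ⟨⟨_, hhi⟩, M', hM'⟩ := hs.mul (.const hi)
  exact ⟨⟨_, hlo.max hhi⟩, max M M', fun x =>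
    abs_max_le_max_abs_abs.trans (max_le_max (hM x) (hM' x))⟩

end Gain

section GainCondExp

variable {Ω E : Type*} {m₀ : MeasurableSpace Ω} {μ : Measure Ω}
  [PseudoMetricSpace E] [MeasurableSpace E] [BorelSpace E] {Y : Ω → E} {T : Ω → ℝ} {lo hi : ℝ}

theorem BddLip.integrable_comp [IsFiniteMeasure μ] {g : E → ℝ} (hg : BddLip g) (hY : Measurable Y) :
    Integrable (fun ω => g (Y ω)) μ :=
  let ⟨M, hM⟩ := hg.2
  .of_bound (hg.continuous.measurable.comp hY).aestronglyMeasurable M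
    (Eventually.of_forall fun _ => hM _)

theorem BddLip.integrable_comp_mul {g : E → ℝ} (hg : BddLip g) (hY : Measurable Y)
    (hT : Integrable T μ) : Integrable (fun ω => g (Y ω) * T ω) μ :=
  let ⟨_, hM⟩ := hg.2
  hT.bdd_mul (hg.continuous.measurable.comp hY).aestronglyMeasurable
    (Eventually.of_forall fun _ => hM _)

theorem condExp_comap_mem_Icc [IsFiniteMeasure μ] (hY : Measurable Y) (hT : Integrable T μ)
    (hlh : lo ≤ hi)
    (h : ∀ s : E → ℝ, BddLip s → 0 ≤ ∫ ω, (gain lo hi (s (Y ω)) - s (Y ω) * T ω) ∂μ) :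
    ∀ᵐ ω ∂μ, (μ[T | MeasurableSpace.comap Y inferInstance]) ω ∈ Set.Icc lo hi := by
  have hhi := condExp_comap_ae_le hY hT (integrable_const hi) fun u hu hu0 => by
    rw [← neg_nonneg, ← integral_neg]
    refine (h u hu).trans_eq (integral_congr_ae (Eventually.of_forall fun ω => ?_))
    simp only [gain_of_nonneg hlh (hu0 _)]
    ring
  have hlo := condExp_comap_ae_le hY (integrable_const lo) hT fun u hu hu0 => by
    rw [← neg_nonneg, ← integral_neg]
    refine (h _ hu.neg).trans_eq (integral_congr_ae (Eventually.of_forall fun ω => ?_))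
    simp only [gain_of_nonpos hlh (neg_nonpos.2 (hu0 _))]
    ring
  rw [condExp_const hY.comap_le] at hhi hlo
  filter_upwards [hlo, hhi] with ω h₁ h₂ using ⟨h₁, h₂⟩

theorem gain_eq_mul_condExp [IsFiniteMeasure μ] (hY : Measurable Y) (hT : Integrable T μ)
    (hmem : ∀ᵐ ω ∂μ, (μ[T | MeasurableSpace.comap Y inferInstance]) ω ∈ Set.Icc lo hi)
    {s : E → ℝ} (hs : BddLip s) (h0 : ∫ ω, (gain lo hi (s (Y ω)) - s (Y ω) * T ω) ∂μ = 0) :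
    ∀ᵐ ω ∂μ, gain lo hi (s (Y ω)) =
      s (Y ω) * (μ[T | MeasurableSpace.comap Y inferInstance]) ω := by
  have hgain := (hs.gain lo hi).integrable_comp (μ := μ) hY
  have hsT := hs.integrable_comp_mul hY hT
  have hsE := hs.integrable_comp_mul hY (integrable_condExp (μ := μ) (f := T)
    (m := MeasurableSpace.comap Y inferInstance))
  rw [integral_sub hgain hsT, ← integral_mul_condExp (g := fun ω => s (Y ω)) hY.comap_le
    (hs.continuous.measurable.comp (comap_measurable Y)).stronglyMeasurable hsT hT,
    ← integral_sub hgain hsE] at h0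
  have hnonneg : 0 ≤ᵐ[μ] fun ω => gain lo hi (s (Y ω)) -
      s (Y ω) * (μ[T | MeasurableSpace.comap Y inferInstance]) ω :=
    hmem.mono fun ω hω => sub_nonneg.2 (mul_le_gain hω _)
  exact ((integral_eq_zero_iff_of_nonneg_ae hnonneg (hgain.sub hsE)).1 h0).mono
    fun ω hω => sub_eq_zero.1 hω

end GainCondExp

/-- The first `n` coordinates of a sequence. -/
def restr (n : ℕ) (x : ℕ → ℝ) : Fin n → ℝ := fun i => x i

theorem continuous_restr (n : ℕ) : Continuous (restr n) :=
  continuous_pi fun i => continuous_apply (i : ℕ)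

theorem measurable_restr (n : ℕ) : Measurable (restr n) := (continuous_restr n).measurable

/-- The filtration in which the `n`-th σ-algebra is generated by the first `n` coordinates. -/
def coordFiltration : Filtration ℕ (inferInstance : MeasurableSpace (ℕ → ℝ)) where
  seq n := MeasurableSpace.comap (restr n) inferInstance
  mono' n k hnk := by
    have hrestr : restr n = (fun (y : Fin k → ℝ) (i : Fin n) => y (Fin.castLE hnk i)) ∘ restr k :=
      rfl
    simp only [hrestr, ← MeasurableSpace.comap_comp]
    exact MeasurableSpace.comap_mono
      (measurable_pi_lambda _ fun i => measurable_pi_apply _).comap_le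
  le' n := (measurable_restr n).comap_le

theorem measurable_apply_coordFiltration {i n : ℕ} (h : i < n) :
    Measurable[coordFiltration n] (fun x : ℕ → ℝ => x i) :=
  (measurable_pi_apply (⟨i, h⟩ : Fin n)).comp (comap_measurable (restr n))

theorem ae_tendsto_sub_clip {Q : Measure (ℕ → ℝ)}
    (hBC : ∑' n : ℕ, Q {x | (n : ℝ) < |x n|} ≠ ∞) :
    ∀ᵐ x ∂Q, Tendsto (fun n : ℕ => x n - clip n (x n)) atTop (𝓝 0) := by
  filter_upwards [ae_eventually_notMem hBC] with x hx
  refine tendsto_const_nhds.congr' (hx.mono fun n hn => ?_)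
  simp only [clip_eq_self (not_lt.1 hn), sub_self]

/-- If no control has positive expected profit beyond its gain and the control `σ` attains its gain,
then, up to an error whose averages vanish, the increments are driven by a drift that is extremal
according to the sign of `σ`. -/
theorem ae_exists_drift {Q : Measure (ℕ → ℝ)} [IsFiniteMeasure Q] {d : ℕ} {lo hi : ℕ → ℝ}
    (hlh : ∀ n, lo n ≤ hi n)
    (hle : ∀ n, d ≤ n → ∀ s : (Fin n → ℝ) → ℝ, BddLip s →
      0 ≤ ∫ x, (gain (lo n) (hi n) (s (restr n x)) - s (restr n x) * clip n (x n)) ∂Q)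
    {σ : ∀ n, (Fin n → ℝ) → ℝ} (hσ : ∀ n, BddLip (σ n))
    (heq : ∀ n, d ≤ n →
      ∫ x, (gain (lo n) (hi n) (σ n (restr n x)) - σ n (restr n x) * clip n (x n)) ∂Q = 0)
    (hsum : Summable fun n : ℕ => (∫ x, clip n (x n) ^ 2 ∂Q) / ((n : ℝ) + 1) ^ 2)
    (hBC : ∑' n : ℕ, Q {x | (n : ℝ) < |x n|} ≠ ∞) :
    ∀ᵐ x ∂Q, ∃ m : ℕ → ℝ, Tendsto (avg (x - m)) atTop (𝓝 0) ∧
      ∀ n, d ≤ n → m n ∈ Set.Icc (lo n) (hi n) ∧ (0 < σ n (restr n x) → m n = hi n) ∧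
        (σ n (restr n x) < 0 → m n = lo n) := by
  set T : ℕ → (ℕ → ℝ) → ℝ := fun n x => clip n (x n)
  have hTm : ∀ n, Measurable[coordFiltration (n + 1)] (T n) := fun n =>
    (continuous_clip n).measurable.comp (measurable_apply_coordFiltration n.lt_succ_self)
  have hT2 : ∀ n, MemLp (T n) 2 Q := fun n =>
    .of_bound ((hTm n).mono (coordFiltration.le _) le_rfl).aestronglyMeasurable n
      (Eventually.of_forall fun x => abs_clip_le n.cast_nonneg _)
  have hT : ∀ n, Integrable (T n) Q := fun n => (hT2 n).integrable one_le_two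
  have hmem : ∀ n, d ≤ n → ∀ᵐ x ∂Q, (Q[T n | coordFiltration n]) x ∈ Set.Icc (lo n) (hi n) :=
    fun n hn => condExp_comap_mem_Icc (measurable_restr n) (hT n) (hlh n) (hle n hn)
  have hopt : ∀ n, d ≤ n → ∀ᵐ x ∂Q, gain (lo n) (hi n) (σ n (restr n x)) =
      σ n (restr n x) * (Q[T n | coordFiltration n]) x := fun n hn =>
    gain_eq_mul_condExp (measurable_restr n) (hT n) (hmem n hn) (hσ n) (heq n hn)
  filter_upwards [ae_all_iff.2 fun n => ae_all_iff.2 fun hn : d ≤ n => (hmem n hn).and (hopt n hn),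
    ae_tendsto_avg_sub_condExp (fun n => (hTm n).stronglyMeasurable) hT2 hsum,
    ae_tendsto_sub_clip hBC] with x hx hnoise htrunc
  refine ⟨fun n => (Q[T n | coordFiltration n]) x, ?_, fun n hn => ⟨(hx n hn).1,
    eq_right_of_gain_eq_mul (hx n hn).1 (hx n hn).2,
    eq_left_of_gain_eq_mul (hx n hn).1 (hx n hn).2⟩⟩
  have hsplit : (x - fun n => (Q[T n | coordFiltration n]) x) =
      (fun n => x n - T n x) + fun n => T n x - (Q[T n | coordFiltration n]) x := by
    ext n
    simp only [Pi.sub_apply, Pi.add_apply, sub_add_sub_cancel]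
  have htrunc' : Tendsto (avg fun n => x n - T n x) atTop (𝓝 0) :=
    htrunc.cesaro.congr fun n => (div_eq_inv_mul _ _).symm
  rw [hsplit, ← add_zero (0 : ℝ)]
  exact (htrunc'.add hnoise).congr fun n => (avg_add _ _ n).symm

/-! ### Cylinder functions -/

/-- `Z` is a bounded Lipschitz function of the first `n` coordinates. -/
def Cyl (n : ℕ) (Z : (ℕ → ℝ) → ℝ) : Prop :=
  ∃ h : (Fin n → ℝ) → ℝ, BddLip h ∧ ∀ x, Z x = h (restr n x)

namespace Cyl

variable {n : ℕ} {Z Z' : (ℕ → ℝ) → ℝ}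

theorem comp_restr {h : (Fin n → ℝ) → ℝ} (hh : BddLip h) : Cyl n fun x => h (restr n x) :=
  ⟨h, hh, fun _ => rfl⟩

theorem integrable (hZ : Cyl n Z) (Q : Measure (ℕ → ℝ)) [IsFiniteMeasure Q] :
    Integrable Z Q := by
  obtain ⟨h, hh, hZ⟩ := hZ
  exact funext hZ ▸ hh.integrable_comp (measurable_restr n)

theorem measurable (hZ : Cyl n Z) : Measurable Z := by
  obtain ⟨h, hh, hZ⟩ := hZ
  exact funext hZ ▸ hh.continuous.measurable.comp (measurable_restr n)

theorem mono (hZ : Cyl n Z) {k : ℕ} (hnk : n ≤ k) : Cyl k Z := by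
  obtain ⟨h, hh, hZ⟩ := hZ
  have hproj : LipschitzWith 1 fun (y : Fin k → ℝ) (i : Fin n) => y (Fin.castLE hnk i) :=
    LipschitzWith.of_dist_le_mul fun y z => by
      rw [NNReal.coe_one, one_mul]
      exact (dist_pi_le_iff dist_nonneg).2 fun i => dist_le_pi_dist y z _
  exact ⟨_, hh.comp hproj, hZ⟩

theorem const (c : ℝ) : Cyl n fun _ => c := comp_restr (.const c)

theorem add (hZ : Cyl n Z) (hZ' : Cyl n Z') : Cyl n fun x => Z x + Z' x := by
  obtain ⟨h, hh, hZ⟩ := hZ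
  obtain ⟨h', hh', hZ'⟩ := hZ'
  exact ⟨_, hh.add hh', fun x => by simp only [hZ, hZ']⟩

theorem mul (hZ : Cyl n Z) (hZ' : Cyl n Z') : Cyl n fun x => Z x * Z' x := by
  obtain ⟨h, hh, hZ⟩ := hZ
  obtain ⟨h', hh', hZ'⟩ := hZ'
  exact ⟨_, hh.mul hh', fun x => by simp only [hZ, hZ']⟩

theorem const_mul (c : ℝ) (hZ : Cyl n Z) : Cyl n fun x => c * Z x := (const c).mul hZ

theorem sub (hZ : Cyl n Z) (hZ' : Cyl n Z') : Cyl n fun x => Z x - Z' x := by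
  simpa only [neg_one_mul, ← sub_eq_add_neg] using hZ.add (hZ'.const_mul (-1))

theorem sum {ι : Type*} (s : Finset ι) {Z : ι → (ℕ → ℝ) → ℝ} (hZ : ∀ i ∈ s, Cyl n (Z i)) :
    Cyl n fun x => ∑ i ∈ s, Z i x := by
  classical
  induction s using Finset.induction_on with
  | empty => exact const 0
  | insert a s ha ih =>
    simp only [Finset.sum_insert ha]
    exact (hZ a (Finset.mem_insert_self a s)).add
      (ih fun i hi => hZ i (Finset.mem_insert_of_mem hi))

theorem clip_apply (c : ℝ) {i : ℕ} (hi : i < n) : Cyl n fun x => clip c (x i) :=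
  comp_restr (.clip c (LipschitzWith.eval (⟨i, hi⟩ : Fin n)))

end Cyl

/-! ### Families of laws of independent and identically distributed sequences -/

section UpE

variable {𝒬 : Set (ProbabilityMeasure (ℕ → ℝ))}

/-- The upper expectation of a family of laws on sequences; the supremum is the intended one for
functions whose integrals are bounded above on the family. -/
def upE (𝒬 : Set (ProbabilityMeasure (ℕ → ℝ))) (Z : (ℕ → ℝ) → ℝ) : ℝ :=
  ⨆ Q : 𝒬, ∫ x, Z x ∂(Q : ProbabilityMeasure (ℕ → ℝ))

/-- The upper mean of the coordinate `x 0` truncated at `c`. -/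
def upperMean (𝒬 : Set (ProbabilityMeasure (ℕ → ℝ))) (c : ℝ) : ℝ := upE 𝒬 fun x => clip c (x 0)

/-- The lower mean of the coordinate `x 0` truncated at `c`. -/
def lowerMean (𝒬 : Set (ProbabilityMeasure (ℕ → ℝ))) (c : ℝ) : ℝ := -upE 𝒬 fun x => -clip c (x 0)

/-- The amount by which the profit `σ n * clip n (x n)` of the control `σ n` falls short of its
gain; the upper expectation of its negative vanishes. -/
def deficit (𝒬 : Set (ProbabilityMeasure (ℕ → ℝ))) (σ : ∀ n, (Fin n → ℝ) → ℝ) (n : ℕ)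
    (x : ℕ → ℝ) : ℝ :=
  gain (lowerMean 𝒬 n) (upperMean 𝒬 n) (σ n (restr n x)) - σ n (restr n x) * clip n (x n)

/-- A family of laws on sequences under whose upper expectation the coordinates are independent
and identically distributed, with compact sets of moments of cylinder functions and uniformly
summable tails. -/
structure IIDFamily (𝒬 : Set (ProbabilityMeasure (ℕ → ℝ))) : Prop where
  nonempty : 𝒬.Nonempty
  compact : ∀ Y : ℕ → (ℕ → ℝ) → ℝ, (∀ j, ∃ n, Cyl n (Y j)) →
    IsCompact ((fun (Q : ProbabilityMeasure (ℕ → ℝ)) (j : ℕ) => ∫ x, Y j x ∂Q) '' 𝒬)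
  indep : ∀ (i : ℕ) (φ : (Fin (i + 1) → ℝ) × ℝ → ℝ), BddLip φ →
    upE 𝒬 (fun x => φ (restr (i + 1) x, x (i + 1))) =
      upE 𝒬 (fun x => upE 𝒬 fun y => φ (restr (i + 1) x, y 0))
  tail : ∃ w : ℕ → ℝ, (∀ k, 0 ≤ w k) ∧ Summable w ∧
    ∀ Q ∈ 𝒬, ∀ n k : ℕ, (Q : Measure (ℕ → ℝ)) {x | (k : ℝ) ≤ |x n|} ≤ ENNReal.ofReal (w k)

theorem upE_const_mul {r : ℝ} (hr : 0 ≤ r) (Z : (ℕ → ℝ) → ℝ) :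
    upE 𝒬 (fun x => r * Z x) = r * upE 𝒬 Z := by
  simp only [upE, integral_const_mul, Real.mul_iSup_of_nonneg hr]

theorem cyl_gain_sub {n : ℕ} {s : (Fin n → ℝ) → ℝ} (hs : BddLip s) (lo hi c : ℝ) :
    Cyl (n + 1) fun x => gain lo hi (s (restr n x)) - s (restr n x) * clip c (x n) :=
  ((Cyl.comp_restr (hs.gain lo hi)).mono n.le_succ).sub
    (((Cyl.comp_restr hs).mono n.le_succ).mul (Cyl.clip_apply c n.lt_succ_self))

theorem cyl_deficit {σ : ∀ n, (Fin n → ℝ) → ℝ} (hσ : ∀ n, BddLip (σ n)) (n : ℕ) :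
    Cyl (n + 1) (deficit 𝒬 σ n) := cyl_gain_sub (hσ n) _ _ _

end UpE

namespace IIDFamily

variable {𝒬 : Set (ProbabilityMeasure (ℕ → ℝ))} {n d : ℕ} {Z Z' : (ℕ → ℝ) → ℝ}
  {σ : ∀ n, (Fin n → ℝ) → ℝ} {Q : ProbabilityMeasure (ℕ → ℝ)}

theorem isCompact_range_integral (h𝒬 : IIDFamily 𝒬) (hZ : Cyl n Z) :
    IsCompact (Set.range fun Q : 𝒬 => ∫ x, Z x ∂(Q : ProbabilityMeasure (ℕ → ℝ))) := by
  have h := (h𝒬.compact (fun _ => Z) fun _ => ⟨n, hZ⟩).image (continuous_apply 0)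
  rwa [Set.image_image, Set.image_eq_range] at h

theorem exists_integral_eq (h𝒬 : IIDFamily 𝒬) (hZ : Cyl n Z) :
    ∃ Q ∈ 𝒬, ∫ x, Z x ∂Q = upE 𝒬 Z := by
  have := h𝒬.nonempty.to_subtype
  obtain ⟨Q, hQ⟩ := (h𝒬.isCompact_range_integral hZ).sSup_mem (Set.range_nonempty _)
  exact ⟨Q, Q.2, hQ⟩

theorem integral_le_upE (h𝒬 : IIDFamily 𝒬) (hZ : Cyl n Z) (hQ : Q ∈ 𝒬) :
    ∫ x, Z x ∂Q ≤ upE 𝒬 Z :=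
  le_ciSup (h𝒬.isCompact_range_integral hZ).bddAbove (⟨Q, hQ⟩ : 𝒬)

theorem upE_sub_le (h𝒬 : IIDFamily 𝒬) (hZ : Cyl n Z) (hZ' : Cyl n Z') {δ : ℝ}
    (h : ∀ Q ∈ 𝒬, ∫ x, |Z x - Z' x| ∂Q ≤ δ) : upE 𝒬 Z - upE 𝒬 Z' ≤ δ := by
  obtain ⟨Q, hQ, he⟩ := h𝒬.exists_integral_eq hZ
  calc upE 𝒬 Z - upE 𝒬 Z' ≤ ∫ x, Z x ∂Q - ∫ x, Z' x ∂Q := by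
        rw [he]
        exact sub_le_sub_left (h𝒬.integral_le_upE hZ' hQ) _
    _ = ∫ x, (Z x - Z' x) ∂Q := (integral_sub (hZ.integrable _) (hZ'.integrable _)).symm
    _ ≤ ∫ x, |Z x - Z' x| ∂Q := (le_abs_self _).trans abs_integral_le_integral_abs
    _ ≤ δ := h Q hQ

theorem upE_const_add (h𝒬 : IIDFamily 𝒬) (a : ℝ) (hZ : Cyl n Z) :
    upE 𝒬 (fun x => a + Z x) = a + upE 𝒬 Z := by
  have := h𝒬.nonempty.to_subtype
  have hint : ∀ Q : 𝒬, ∫ x, (a + Z x) ∂(Q : ProbabilityMeasure (ℕ → ℝ)) =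
      a + ∫ x, Z x ∂(Q : ProbabilityMeasure (ℕ → ℝ)) := fun Q => by
    rw [integral_add (integrable_const a) (hZ.integrable _), integral_const, probReal_univ,
      one_smul]
  simp only [upE, hint]
  exact (add_ciSup (h𝒬.isCompact_range_integral hZ).bddAbove a).symm

theorem upE_const (h𝒬 : IIDFamily 𝒬) (a : ℝ) : upE 𝒬 (fun _ => a) = a := by
  have := h𝒬.nonempty.to_subtype
  simp only [upE, integral_const, probReal_univ, one_smul, ciSup_const]

theorem lowerMean_le_upperMean (h𝒬 : IIDFamily 𝒬) (c : ℝ) : lowerMean 𝒬 c ≤ upperMean 𝒬 c := by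
  obtain ⟨Q, hQ⟩ := h𝒬.nonempty
  have hclip : Cyl 1 fun x => clip c (x 0) := Cyl.clip_apply c zero_lt_one
  have hneg := h𝒬.integral_le_upE (hclip.const_mul (-1)) hQ
  simp only [neg_one_mul, integral_neg] at hneg
  exact (neg_le.1 hneg).trans (h𝒬.integral_le_upE hclip hQ)

theorem upE_mul_clip (h𝒬 : IIDFamily 𝒬) (s c : ℝ) :
    upE 𝒬 (fun x => s * clip c (x 0)) = gain (lowerMean 𝒬 c) (upperMean 𝒬 c) s := by
  rcases le_total 0 s with hs | hs
  · rw [gain_of_nonneg (h𝒬.lowerMean_le_upperMean c) hs, upE_const_mul hs, upperMean]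
  · rw [gain_of_nonpos (h𝒬.lowerMean_le_upperMean c) hs, lowerMean, mul_neg, ← neg_mul,
      ← upE_const_mul (neg_nonneg.2 hs)]
    simp only [neg_mul_neg]

theorem upE_add_control (h𝒬 : IIDFamily 𝒬) (hn : 1 ≤ n) (c : ℝ) {W s : (Fin n → ℝ) → ℝ}
    (hW : BddLip W) (hs : BddLip s) :
    upE 𝒬 (fun x => W (restr n x) - (gain (lowerMean 𝒬 c) (upperMean 𝒬 c) (s (restr n x)) -
      s (restr n x) * clip c (x n))) = upE 𝒬 fun x => W (restr n x) := by
  obtain ⟨i, rfl⟩ : ∃ i, n = i + 1 := ⟨n - 1, by omega⟩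
  have hφ : BddLip fun p : (Fin (i + 1) → ℝ) × ℝ =>
      W p.1 - (gain (lowerMean 𝒬 c) (upperMean 𝒬 c) (s p.1) - s p.1 * clip c p.2) :=
    (hW.comp LipschitzWith.prod_fst).sub (((hs.comp LipschitzWith.prod_fst).gain _ _).sub
      ((hs.comp LipschitzWith.prod_fst).mul (BddLip.clip c LipschitzWith.prod_snd)))
  rw [h𝒬.indep i _ hφ]
  congr 1 with x
  simp only [sub_sub_eq_add_sub, add_sub_right_comm]
  rw [h𝒬.upE_const_add _ ((Cyl.clip_apply c zero_lt_one).const_mul _), h𝒬.upE_mul_clip,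
    sub_add_cancel]

theorem integral_gain_sub_nonneg (h𝒬 : IIDFamily 𝒬) (hn : 1 ≤ n) (c : ℝ)
    {s : (Fin n → ℝ) → ℝ} (hs : BddLip s) (hQ : Q ∈ 𝒬) :
    0 ≤ ∫ x, (gain (lowerMean 𝒬 c) (upperMean 𝒬 c) (s (restr n x)) -
      s (restr n x) * clip c (x n)) ∂Q := by
  have hcyl : Cyl (n + 1) fun x => 0 - (gain (lowerMean 𝒬 c) (upperMean 𝒬 c) (s (restr n x)) -
      s (restr n x) * clip c (x n)) := (Cyl.const 0).sub (cyl_gain_sub hs _ _ c)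
  have hle := (h𝒬.integral_le_upE hcyl hQ).trans_eq <|
    (h𝒬.upE_add_control hn c (.const 0) hs).trans (h𝒬.upE_const 0)
  simpa only [zero_sub, integral_neg, neg_nonpos] using hle

theorem cyl_sub_deficit (hZ : Cyl d Z) (hσ : ∀ n, BddLip (σ n)) (k : ℝ) (N : ℕ) :
    Cyl (d + N) fun x => Z x - k * ∑ n ∈ Finset.range N, deficit 𝒬 σ (d + n) x :=
  (hZ.mono (Nat.le_add_right _ _)).sub <| (Cyl.sum _ fun n hn => (cyl_deficit hσ (d + n)).mono
    (Nat.add_le_add_left (Finset.mem_range.1 hn) d)).const_mul k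

theorem upE_sub_deficit (h𝒬 : IIDFamily 𝒬) (hd : 1 ≤ d) (hZ : Cyl d Z) (hσ : ∀ n, BddLip (σ n))
    {k : ℝ} (hk : 0 ≤ k) (N : ℕ) :
    upE 𝒬 (fun x => Z x - k * ∑ n ∈ Finset.range N, deficit 𝒬 σ (d + n) x) = upE 𝒬 Z := by
  induction N with
  | zero => simp only [Finset.sum_range_zero, mul_zero, sub_zero]
  | succ N ih =>
    obtain ⟨W, hW, hWeq⟩ := cyl_sub_deficit (𝒬 := 𝒬) hZ hσ k N
    rw [← ih, funext hWeq, ← h𝒬.upE_add_control (n := d + N) (hd.trans (Nat.le_add_right d N))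
      ((d + N : ℕ) : ℝ) hW ((hσ (d + N)).const_mul k)]
    congr 1 with x
    rw [← hWeq, Finset.sum_range_succ, deficit, gain_mul hk]
    ring

theorem exists_deficit_eq_zero (h𝒬 : IIDFamily 𝒬) (hd : 1 ≤ d) {f : ℕ → (ℕ → ℝ) → ℝ}
    (hf : ∀ j, Cyl d (f j)) {Q₀ : ProbabilityMeasure (ℕ → ℝ)} (hQ₀ : Q₀ ∈ 𝒬)
    (hmax : ∀ j, ∀ Q ∈ 𝒬, (∀ i < j, ∫ x, f i x ∂Q = ∫ x, f i x ∂Q₀) →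
      ∫ x, f j x ∂Q ≤ ∫ x, f j x ∂Q₀)
    (hσ : ∀ n, BddLip (σ n)) :
    ∃ Q ∈ 𝒬, (∀ j, ∫ x, f j x ∂Q = ∫ x, f j x ∂Q₀) ∧
      ∀ n, d ≤ n → ∫ x, deficit 𝒬 σ n x ∂Q = 0 := by
  have hsum : ∀ (a : ℕ →₀ ℝ) (Q : ProbabilityMeasure (ℕ → ℝ)),
      ∫ x, (a.sum fun i r => r * f i x) ∂Q = a.sum fun i r => r * ∫ x, f i x ∂Q := fun a Q => by
    simp only [Finsupp.sum, integral_const_mul, integral_finsetSum _ fun i _ =>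
      ((hf i).const_mul _).integrable (Q : Measure (ℕ → ℝ))]
  let Y : ℕ ⊕ ℕ → (ℕ → ℝ) → ℝ := Sum.elim f fun n => deficit 𝒬 σ (d + n)
  have hY : ∀ j, ∃ n, Cyl n (Y j) := by
    rintro (j | n)
    exacts [⟨d, hf j⟩, ⟨_, cyl_deficit hσ (d + n)⟩]
  have hcompact := (h𝒬.compact (fun k => Y (Denumerable.ofNat _ k)) fun k => hY _).image
    (f := fun (y : ℕ → ℝ) (j : ℕ ⊕ ℕ) => y (Encodable.encode j))
    (continuous_pi fun j => continuous_apply _)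
  simp only [Set.image_image, Denumerable.ofNat_encode] at hcompact
  obtain ⟨_, ⟨Q, hQ, rfl⟩, hfQ, hdQ⟩ := exists_forall_eq_of_penalty hcompact
    (g := fun j y => y (.inl j)) (h := fun n y => y (.inr n))
    (p := fun j => ∫ x, f j x ∂(Q₀ : Measure (ℕ → ℝ)))
    (fun _ => continuous_apply _) (fun _ => continuous_apply _)
    (fun n => Set.forall_mem_image.2 fun Q hQ =>
      h𝒬.integral_gain_sub_nonneg (hd.trans (Nat.le_add_right d n)) _ (hσ _) hQ)
    (fun j => Set.forall_mem_image.2 fun Q hQ h => hmax j Q hQ h)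
    (fun a N => by
      have hZ : Cyl d fun x => a.sum fun i r => r * f i x :=
        Cyl.sum _ fun i _ => (hf i).const_mul _
      obtain ⟨Q, hQ, he⟩ := h𝒬.exists_integral_eq (cyl_sub_deficit (𝒬 := 𝒬) hZ hσ N N)
      have hdef := fun n => (cyl_deficit (𝒬 := 𝒬) hσ (d + n)).integrable (Q : Measure (ℕ → ℝ))
      refine ⟨_, ⟨Q, hQ, rfl⟩, ?_⟩
      have h := h𝒬.integral_le_upE hZ hQ₀
      rwa [← h𝒬.upE_sub_deficit hd hZ hσ N.cast_nonneg N, ← he, integral_sub (hZ.integrable _)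
        ((integrable_finsetSum _ fun n _ => hdef n).const_mul _), integral_const_mul,
        integral_finsetSum _ fun n _ => hdef n, hsum, hsum] at h)
  refine ⟨Q, hQ, hfQ, fun n hn => ?_⟩
  obtain ⟨k, rfl⟩ := Nat.exists_eq_add_of_le hn
  exact hdQ k

theorem exists_optimal (h𝒬 : IIDFamily 𝒬) (hd : 1 ≤ d) {f : ℕ → (ℕ → ℝ) → ℝ}
    (hf : ∀ j, Cyl d (f j)) :
    ∃ Q₀ ∈ 𝒬, ∀ σ : ∀ n, (Fin n → ℝ) → ℝ, (∀ n, BddLip (σ n)) →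
      ∃ Q ∈ 𝒬, (∀ j, ∫ x, f j x ∂Q = ∫ x, f j x ∂Q₀) ∧
        ∀ n, d ≤ n → ∫ x, deficit 𝒬 σ n x ∂Q = 0 := by
  obtain ⟨_, ⟨Q₀, hQ₀, rfl⟩, hmax⟩ :=
    exists_lexMax (h𝒬.compact f fun j => ⟨d, hf j⟩) (h𝒬.nonempty.image _)
  exact ⟨Q₀, hQ₀, fun σ hσ => h𝒬.exists_deficit_eq_zero hd hf hQ₀
    (fun j Q hQ h => hmax j _ ⟨Q, hQ, rfl⟩ h) hσ⟩

end IIDFamily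

/-! ### Tail estimates -/

section Tails

theorem min_sq_le_sum_indicator {a : ℝ} (ha : 0 ≤ a) (n : ℕ) :
    min a n ^ 2 ≤ ∑ k ∈ Finset.range n, (2 * (k : ℝ) + 1) * (Set.Iic a).indicator 1 (k : ℝ) := by
  induction n with
  | zero => simp [ha]
  | succ n ih =>
    rw [Finset.sum_range_succ]
    rcases le_or_gt (n : ℝ) a with h | h
    · rw [Set.indicator_of_mem (Set.mem_Iic.2 h), Pi.one_apply, mul_one]
      rw [min_eq_right h] at ih
      have hmin : min a ((n + 1 : ℕ) : ℝ) ≤ n + 1 := (min_le_right _ _).trans_eq n.cast_succ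
      nlinarith [le_min ha (n + 1).cast_nonneg]
    · rw [Set.indicator_of_notMem (Set.notMem_Iic.2 h), mul_zero, add_zero,
        min_eq_left (h.le.trans (Nat.cast_le.2 n.le_succ))]
      rwa [min_eq_left h.le] at ih

theorem summable_sum_div_sq {w : ℕ → ℝ} (hw₀ : ∀ k, 0 ≤ w k) (hw : Summable w) :
    Summable fun n : ℕ => (∑ k ∈ Finset.range n, (2 * k + 1) * w k) / ((n : ℝ) + 1) ^ 2 := by
  have hv₀ : ∀ k : ℕ, 0 ≤ (2 * k + 1) * w k := fun k => mul_nonneg (by positivity) (hw₀ k)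
  refine summable_of_sum_range_le (c := 4 * ∑' k, w k) (fun n =>
    div_nonneg (Finset.sum_nonneg fun k _ => hv₀ k) (by positivity)) fun N => ?_
  calc ∑ n ∈ Finset.range N, (∑ k ∈ Finset.range n, (2 * k + 1) * w k) / ((n : ℝ) + 1) ^ 2
      ≤ ∑ n ∈ Finset.range N, ∑ k ∈ Finset.range n, ((n : ℝ) ^ 2)⁻¹ * ((2 * k + 1) * w k) := by
        refine Finset.sum_le_sum fun n _ => ?_
        rcases n.eq_zero_or_pos with rfl | hn
        · simp
        · rw [← Finset.mul_sum, div_eq_inv_mul]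
          have : (0 : ℝ) < n := Nat.cast_pos.2 hn
          have := Finset.sum_nonneg fun k (_ : k ∈ Finset.range n) => hv₀ k
          gcongr
          linarith
    _ = ∑ k ∈ Finset.range N, ∑ n ∈ Finset.Ioo k N, ((n : ℝ) ^ 2)⁻¹ * ((2 * k + 1) * w k) :=
        Finset.sum_comm' fun n k => by simp only [Finset.mem_range, Finset.mem_Ioo]; omega
    _ ≤ ∑ k ∈ Finset.range N, 4 * w k := by
        refine Finset.sum_le_sum fun k _ => ?_
        rw [← Finset.sum_mul]
        refine (mul_le_mul_of_nonneg_right (sum_Ioo_inv_sq_le (α := ℝ) k N) (hv₀ k)).trans ?_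
        rw [div_mul_eq_mul_div, div_le_iff₀ (by positivity)]
        linarith [hw₀ k]
    _ ≤ 4 * ∑' k, w k := by
        rw [← Finset.mul_sum]
        exact mul_le_mul_of_nonneg_left (hw.sum_le_tsum _ fun k _ => hw₀ k) zero_le_four

theorem ofReal_le_tsum_indicator (t : ℝ) :
    ENNReal.ofReal t ≤ ∑' k : ℕ, (Set.Iic t).indicator 1 (k : ℝ) :=
  calc ENNReal.ofReal t ≤ ENNReal.ofReal ⌈t⌉₊ := ENNReal.ofReal_le_ofReal (Nat.le_ceil t)
    _ = ∑ _ ∈ Finset.range ⌈t⌉₊, (1 : ℝ≥0∞) := by simp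
    _ = ∑ k ∈ Finset.range ⌈t⌉₊, (Set.Iic t).indicator 1 (k : ℝ) :=
        Finset.sum_congr rfl fun k hk => (Set.indicator_of_mem
          (Set.mem_Iic.2 (Nat.lt_ceil.1 (Finset.mem_range.1 hk)).le) 1).symm
    _ ≤ _ := ENNReal.sum_le_tsum _

theorem abs_clip_sub_clip_le {K c c' : ℝ} (hK : 0 ≤ K) (hc : K ≤ c) (hc' : K ≤ c') (y : ℝ) :
    |clip c y - clip c' y| ≤ max (|y| - K) 0 := by
  simp only [clip]
  grind

variable {Ω : Type*} [MeasurableSpace Ω] {μ : Measure Ω}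

theorem lintegral_ofReal_le_tsum_measure {f : Ω → ℝ} (hf : Measurable f) :
    ∫⁻ ω, ENNReal.ofReal (f ω) ∂μ ≤ ∑' k : ℕ, μ {ω | (k : ℝ) ≤ f ω} := by
  have hmeas : ∀ k : ℕ, MeasurableSet {ω | (k : ℝ) ≤ f ω} := fun k =>
    measurableSet_le measurable_const hf
  calc ∫⁻ ω, ENNReal.ofReal (f ω) ∂μ
      ≤ ∫⁻ ω, ∑' k : ℕ, {ω | (k : ℝ) ≤ f ω}.indicator 1 ω ∂μ :=
        lintegral_mono fun ω => ofReal_le_tsum_indicator (f ω)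
    _ = ∑' k : ℕ, μ {ω | (k : ℝ) ≤ f ω} := by
        rw [lintegral_tsum fun k => (measurable_one.indicator (hmeas k)).aemeasurable]
        exact tsum_congr fun k => lintegral_indicator_one (hmeas k)

variable {Z : Ω → ℝ} {w : ℕ → ℝ}

theorem integral_clip_sq_le [IsFiniteMeasure μ] (hZ : Measurable Z) (hw₀ : ∀ k, 0 ≤ w k)
    (hw : ∀ k : ℕ, μ {ω | (k : ℝ) ≤ |Z ω|} ≤ ENNReal.ofReal (w k)) (n : ℕ) :
    ∫ ω, clip n (Z ω) ^ 2 ∂μ ≤ ∑ k ∈ Finset.range n, (2 * k + 1) * w k := by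
  have hmeas : ∀ k : ℕ, MeasurableSet {ω | (k : ℝ) ≤ |Z ω|} := fun k =>
    measurableSet_le measurable_const hZ.abs
  have hint : ∀ k : ℕ, Integrable (fun ω => (2 * (k : ℝ) + 1) *
      {ω | (k : ℝ) ≤ |Z ω|}.indicator 1 ω) μ := fun k =>
    ((integrable_const 1).indicator (hmeas k)).const_mul _
  calc ∫ ω, clip n (Z ω) ^ 2 ∂μ
      ≤ ∫ ω, ∑ k ∈ Finset.range n, (2 * (k : ℝ) + 1) * {ω | (k : ℝ) ≤ |Z ω|}.indicator 1 ω ∂μ := by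
        refine integral_mono_of_nonneg (.of_forall fun ω => sq_nonneg _)
          (integrable_finsetSum _ fun k _ => hint k) (.of_forall fun ω => ?_)
        beta_reduce
        rw [← sq_abs (clip n (Z ω)), abs_clip n.cast_nonneg]
        exact min_sq_le_sum_indicator (abs_nonneg (Z ω)) n
    _ = ∑ k ∈ Finset.range n, (2 * (k : ℝ) + 1) * μ.real {ω | (k : ℝ) ≤ |Z ω|} := by
        rw [integral_finsetSum _ fun k _ => hint k]
        exact Finset.sum_congr rfl fun k _ => by
          rw [integral_const_mul, integral_indicator_one (hmeas k)]
    _ ≤ ∑ k ∈ Finset.range n, (2 * k + 1) * w k :=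
        Finset.sum_le_sum fun k _ => mul_le_mul_of_nonneg_left
          (ENNReal.toReal_le_of_le_ofReal (hw₀ k) (hw k)) (by positivity)

theorem integral_abs_clip_sub_clip_le (hZ : Measurable Z) (hw₀ : ∀ k, 0 ≤ w k) (hws : Summable w)
    (hw : ∀ k : ℕ, μ {ω | (k : ℝ) ≤ |Z ω|} ≤ ENNReal.ofReal (w k)) {K : ℕ} {c c' : ℝ}
    (hc : K ≤ c) (hc' : K ≤ c') :
    ∫ ω, |clip c (Z ω) - clip c' (Z ω)| ∂μ ≤ ∑' k, w (k + K) := by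
  have hcont : Continuous fun y => |clip c y - clip c' y| :=
    ((continuous_clip c).sub (continuous_clip c')).abs
  rw [integral_eq_lintegral_of_nonneg_ae (.of_forall fun ω => abs_nonneg _)
    (hcont.measurable.comp hZ).aestronglyMeasurable]
  refine ENNReal.toReal_le_of_le_ofReal (tsum_nonneg fun k => hw₀ _) ?_
  calc ∫⁻ ω, ENNReal.ofReal |clip c (Z ω) - clip c' (Z ω)| ∂μ
      ≤ ∫⁻ ω, ENNReal.ofReal (|Z ω| - K) ∂μ := lintegral_mono fun ω => by
        simpa only [ENNReal.ofReal_max, ENNReal.ofReal_zero, max_zero] using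
          ENNReal.ofReal_le_ofReal (abs_clip_sub_clip_le K.cast_nonneg hc hc' (Z ω))
    _ ≤ ∑' k : ℕ, μ {ω | (k : ℝ) ≤ |Z ω| - K} :=
        lintegral_ofReal_le_tsum_measure (hZ.abs.sub_const _)
    _ ≤ ∑' k : ℕ, ENNReal.ofReal (w (k + K)) := ENNReal.tsum_le_tsum fun k => by
        simpa only [le_sub_iff_add_le, ← Nat.cast_add] using hw (k + K)
    _ = ENNReal.ofReal (∑' k, w (k + K)) :=
        (ENNReal.ofReal_tsum_of_nonneg (fun k => hw₀ _) ((summable_nat_add_iff K).2 hws)).symm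

end Tails

namespace IIDFamily

variable {𝒬 : Set (ProbabilityMeasure (ℕ → ℝ))} {Q : ProbabilityMeasure (ℕ → ℝ)}

theorem summable_integral_clip_sq_div (h𝒬 : IIDFamily 𝒬) (hQ : Q ∈ 𝒬) :
    Summable fun n : ℕ => (∫ x : ℕ → ℝ, clip n (x n) ^ 2 ∂Q) / ((n : ℝ) + 1) ^ 2 := by
  obtain ⟨w, hw₀, hws, hw⟩ := h𝒬.tail
  refine (summable_sum_div_sq hw₀ hws).of_nonneg_of_le
    (fun n => div_nonneg (integral_nonneg fun x => sq_nonneg _) (by positivity)) fun n => ?_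
  gcongr
  exact integral_clip_sq_le (measurable_pi_apply n) hw₀ (hw Q hQ n) n

theorem tsum_measure_lt_abs_ne_top (h𝒬 : IIDFamily 𝒬) (hQ : Q ∈ 𝒬) :
    ∑' n : ℕ, (Q : Measure (ℕ → ℝ)) {x | (n : ℝ) < |x n|} ≠ ∞ := by
  obtain ⟨w, -, hws, hw⟩ := h𝒬.tail
  exact ne_top_of_le_ne_top hws.tsum_ofReal_ne_top <| ENNReal.tsum_le_tsum fun n =>
    (measure_mono fun x (hx : (n : ℝ) < |(x : ℕ → ℝ) n|) => hx.le).trans (hw Q hQ n n)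

theorem exists_tendsto_upE_mul_clip (h𝒬 : IIDFamily 𝒬) (s : ℝ) :
    ∃ m, Tendsto (fun c : ℝ => upE 𝒬 fun x => s * clip c (x 0)) atTop (𝓝 m) := by
  obtain ⟨w, hw₀, hws, hw⟩ := h𝒬.tail
  have hcyl : ∀ c, Cyl 1 fun x => s * clip c (x 0) := fun c =>
    (Cyl.clip_apply c zero_lt_one).const_mul s
  have hdiff : ∀ {K : ℕ} {c c' : ℝ}, K ≤ c → K ≤ c' →
      upE 𝒬 (fun x => s * clip c (x 0)) - upE 𝒬 (fun x => s * clip c' (x 0)) ≤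
        |s| * ∑' k, w (k + K) := fun hc hc' => by
    refine h𝒬.upE_sub_le (hcyl _) (hcyl _) fun Q hQ => ?_
    simp only [← mul_sub, abs_mul, integral_const_mul]
    exact mul_le_mul_of_nonneg_left (integral_abs_clip_sub_clip_le (measurable_pi_apply 0) hw₀ hws
      (hw Q hQ 0) hc hc') (abs_nonneg s)
  have htail : Tendsto (fun K => |s| * ∑' k, w (k + K)) atTop (𝓝 0) := by
    simpa only [mul_zero] using (tendsto_sum_nat_add w).const_mul |s|
  refine cauchySeq_tendsto_of_complete (Metric.cauchySeq_iff'.2 fun ε hε => ?_)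
  obtain ⟨K, hK⟩ := (htail.eventually_lt_const hε).exists
  exact ⟨K, fun c hc => (abs_sub_le_iff.2 ⟨hdiff hc le_rfl, hdiff le_rfl hc⟩).trans_lt hK⟩

end IIDFamily

/-! ### Approximation by cylinder functions -/

theorem exists_bddLip_forall_dist_lt {E : Type*} [PseudoMetricSpace E] {K : Set E}
    (hK : IsCompact K) (f : E →ᵇ ℝ) {ε : ℝ} (hε : 0 < ε) :
    ∃ g : E → ℝ, BddLip g ∧ (∀ x, |g x| ≤ ‖f‖) ∧ ∀ x ∈ K, dist (f x) (g x) < ε := by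
  have hf : ∀ x, |f x| ≤ ‖f‖ := f.norm_coe_le_norm
  have hm : ∀ x, -‖f‖ ≤ f x := fun x => (abs_le.1 (hf x)).1
  have hlim := Monotone.tendstoUniformlyOn_of_forall_tendsto hK
    (fun k => (bddLip_lipLower hf k).continuous.continuousOn)
    (fun x _ _ _ hkl => lipLower_mono hm hkl x) f.continuous.continuousOn
    (fun x _ => tendsto_lipLower hm f.continuous.continuousAt)
  obtain ⟨k, hk⟩ := (Metric.tendstoUniformlyOn_iff.1 hlim ε hε).exists
  exact ⟨lipLower f k, bddLip_lipLower hf k, fun x =>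
    abs_le.2 ⟨le_lipLower hm k x, (lipLower_le hm k x).trans (abs_le.1 (hf x)).2⟩, hk⟩

/-- Extension of a finite sequence by zeros. -/
def pad (n : ℕ) (y : Fin n → ℝ) : ℕ → ℝ := fun i => if h : i < n then y ⟨i, h⟩ else 0

theorem continuous_pad (n : ℕ) : Continuous (pad n) :=
  continuous_pi fun i => by
    by_cases h : i < n
    · simpa only [pad, h, dite_true] using continuous_apply _
    · simpa only [pad, h, dite_false] using continuous_const

theorem tendsto_pad_restr (x : ℕ → ℝ) :
    Tendsto (fun p : ℕ × (ℕ → ℝ) => pad p.1 (restr p.1 p.2)) (atTop ×ˢ 𝓝 x) (𝓝 x) := by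
  refine tendsto_pi_nhds.2 fun i => ?_
  refine (((continuous_apply i).tendsto x).comp tendsto_snd).congr' ?_
  filter_upwards [tendsto_fst.eventually (eventually_gt_atTop i)] with p hp
  simp only [pad, hp, dite_true, restr, Function.comp_apply]

theorem exists_cyl_forall_dist_lt {K : Set (ℕ → ℝ)} (hK : IsCompact K) (f : (ℕ → ℝ) →ᵇ ℝ) {ε : ℝ}
    (hε : 0 < ε) :
    ∃ (n : ℕ) (Y : (ℕ → ℝ) → ℝ), Cyl n Y ∧ (∀ x, |Y x| ≤ ‖f‖) ∧ ∀ x ∈ K, dist (f x) (Y x) < ε := by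
  have hlim : TendstoUniformlyOn (fun n x => f (pad n (restr n x))) f atTop K := by
    refine (tendstoLocallyUniformlyOn_iff_tendstoUniformlyOn_of_compact hK).1 <|
      tendstoLocallyUniformlyOn_iff_forall_tendsto.2 fun x _ => ?_
    have hf := f.continuous.tendsto x
    exact (((hf.comp tendsto_snd).prodMk_nhds (hf.comp (tendsto_pad_restr x))).mono_left
      (prod_mono_right atTop nhdsWithin_le_nhds)).mono_right (nhds_le_uniformity (f x))
  obtain ⟨n, hn⟩ := (Metric.tendstoUniformlyOn_iff.1 hlim (ε / 2) (half_pos hε)).exists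
  let fn := f.compContinuous ⟨pad n, continuous_pad n⟩
  obtain ⟨g, hg, hgf, hgK⟩ :=
    exists_bddLip_forall_dist_lt (hK.image (continuous_restr n)) fn (half_pos hε)
  refine ⟨n, _, Cyl.comp_restr hg, fun x => (hgf _).trans (f.norm_compContinuous_le _),
    fun x hx => ?_⟩
  calc dist (f x) (g (restr n x))
      ≤ dist (f x) (f (pad n (restr n x))) + dist (fn (restr n x)) (g (restr n x)) :=
        dist_triangle _ _ _
    _ < ε / 2 + ε / 2 := add_lt_add (hn x hx) (hgK _ (Set.mem_image_of_mem _ hx))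
    _ = ε := add_halves ε

theorem isTightMeasureSet_of_forall_coord {S : Set (Measure (ℕ → ℝ))}
    (h : ∀ n, ∀ ε : ℝ≥0∞, ε ≠ 0 → ∃ k : ℝ, ∀ μ ∈ S, μ {x | k ≤ |x n|} ≤ ε) :
    IsTightMeasureSet S := by
  refine isTightMeasureSet_iff_exists_isCompact_measure_compl_le.2 fun ε hε => ?_
  obtain ⟨δ, hδ, hδε⟩ := ENNReal.exists_pos_sum_of_countable' hε.ne' ℕ
  choose k hk using fun n => h n (δ n) (hδ n).ne'
  refine ⟨Set.univ.pi fun n => Set.Icc (-k n) (k n), isCompact_univ_pi fun n => isCompact_Icc,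
    fun μ hμ => ?_⟩
  calc μ (Set.univ.pi fun n => Set.Icc (-k n) (k n))ᶜ
      ≤ μ (⋃ n, {x | k n ≤ |x n|}) := by
        refine measure_mono fun x hx => ?_
        obtain ⟨n, -, hn⟩ : ∃ n, n ∈ Set.univ ∧ x n ∉ Set.Icc (-k n) (k n) := by
          simpa only [Set.mem_compl_iff, Set.mem_pi, not_forall, exists_prop] using hx
        rw [Set.mem_Icc, ← abs_le, not_le] at hn
        exact Set.mem_iUnion.2 ⟨n, hn.le⟩
    _ ≤ ∑' n, δ n := (measure_iUnion_le _).trans (ENNReal.tsum_le_tsum fun n => hk n μ hμ)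
    _ ≤ ε := hδε.le

theorem exists_cyl_lintegral_edist_le {𝒬 : Set (ProbabilityMeasure (ℕ → ℝ))}
    (h𝒬 : IsTightMeasureSet {μ : Measure (ℕ → ℝ) | ∃ Q ∈ 𝒬, ↑Q = μ}) (f : (ℕ → ℝ) →ᵇ ℝ) {ε : ℝ}
    (hε : 0 < ε) :
    ∃ (n : ℕ) (Y : (ℕ → ℝ) → ℝ), Cyl n Y ∧
      ∀ Q ∈ 𝒬, ∫⁻ x, edist (f x) (Y x) ∂(Q : Measure (ℕ → ℝ)) ≤ ENNReal.ofReal ε := by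
  let δ := ε / (2 * (2 * ‖f‖ + 1))
  have hδ : 0 < δ := by positivity
  obtain ⟨K, hK, hKδ⟩ := isTightMeasureSet_iff_exists_isCompact_measure_compl_le.1 h𝒬
    (ENNReal.ofReal δ) (ENNReal.ofReal_pos.2 hδ)
  obtain ⟨n, Y, hY, hYf, hYK⟩ := exists_cyl_forall_dist_lt hK f (half_pos hε)
  refine ⟨n, Y, hY, fun Q hQ => ?_⟩
  have hbound : ∀ x, edist (f x) (Y x) ≤ ENNReal.ofReal (2 * ‖f‖ + 1) := fun x => by
    rw [edist_dist]
    refine ENNReal.ofReal_le_ofReal ((dist_le_norm_add_norm _ _).trans ?_)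
    linarith [f.norm_coe_le_norm x, hYf x, Real.norm_eq_abs (Y x)]
  rw [← lintegral_add_compl _ hK.measurableSet]
  calc _ ≤ ENNReal.ofReal (ε / 2) * (Q : Measure (ℕ → ℝ)) K +
        ENNReal.ofReal (2 * ‖f‖ + 1) * (Q : Measure (ℕ → ℝ)) Kᶜ := by
        refine add_le_add ((setLIntegral_mono' hK.measurableSet fun x hx => ?_).trans_eq
          (setLIntegral_const _ _)) ((lintegral_mono hbound).trans_eq (setLIntegral_const _ _))
        rw [edist_dist]
        exact ENNReal.ofReal_le_ofReal (hYK x hx).le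
    _ ≤ ENNReal.ofReal (ε / 2) * 1 + ENNReal.ofReal (2 * ‖f‖ + 1) * ENNReal.ofReal δ := by
        gcongr
        · exact prob_le_one
        · exact hKδ _ ⟨Q, hQ, rfl⟩
    _ = ENNReal.ofReal ε := by
        rw [mul_one, ← ENNReal.ofReal_mul (by positivity), ← ENNReal.ofReal_add (by positivity)
          (by positivity)]
        congr 1
        simp only [δ]
        field_simp
        ring

theorem exists_tendsto_restr_of_cyl {Y : ℕ → (ℕ → ℝ) → ℝ} (hY : ∀ k, ∃ n, Cyl n (Y k)) :
    ∃ τ : ∀ n, (Fin n → ℝ) → ℝ, (∀ n, BddLip (τ n)) ∧ ∀ x t,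
      Tendsto (fun k => Y k x) atTop (𝓝 t) →
        Tendsto (fun n => τ n (restr n x)) atTop (𝓝 t) := by
  choose N hN using hY
  let κ : ℕ → ℕ := fun n => Nat.findGreatest (fun k => N k ≤ n) n
  have hκ : Tendsto κ atTop atTop := by
    refine tendsto_atTop.2 fun k => ?_
    filter_upwards [eventually_ge_atTop k, eventually_ge_atTop (N k)] with n hk hn
    exact Nat.le_findGreatest hk hn
  have hκN : ∀ n, N 0 ≤ n → N (κ n) ≤ n := fun n =>
    Nat.findGreatest_spec (P := fun k => N k ≤ n) n.zero_le
  have hτ : ∀ n, ∃ τ : (Fin n → ℝ) → ℝ, BddLip τ ∧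
      (N 0 ≤ n → ∀ x, Y (κ n) x = τ (restr n x)) := fun n => by
    by_cases hn : N 0 ≤ n
    · obtain ⟨τ, hτ, h⟩ := (hN (κ n)).mono (hκN n hn)
      exact ⟨τ, hτ, fun _ => h⟩
    · exact ⟨_, .const 0, fun h => absurd h hn⟩
  choose τ hτ hYτ using hτ
  refine ⟨τ, hτ, fun x t hx => (hx.comp hκ).congr' ?_⟩
  filter_upwards [eventually_ge_atTop (N 0)] with n hn using hYτ n hn x

namespace IIDFamily

variable {𝒬 : Set (ProbabilityMeasure (ℕ → ℝ))}

theorem isTightMeasureSet (h𝒬 : IIDFamily 𝒬) :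
    IsTightMeasureSet {μ : Measure (ℕ → ℝ) | ∃ Q ∈ 𝒬, ↑Q = μ} := by
  obtain ⟨w, -, hw, htail⟩ := h𝒬.tail
  have hw0 : Tendsto (fun k => ENNReal.ofReal (w k)) atTop (𝓝 0) := by
    simpa only [ENNReal.ofReal_zero] using ENNReal.tendsto_ofReal hw.tendsto_atTop_zero
  refine isTightMeasureSet_of_forall_coord fun n ε hε => ?_
  obtain ⟨k, hk⟩ := (hw0.eventually_le_const (pos_iff_ne_zero.2 hε)).exists
  exact ⟨k, by rintro _ ⟨Q, hQ, rfl⟩; exact (htail Q hQ n k).trans hk⟩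

theorem exists_cyl_tendsto_ae (h𝒬 : IIDFamily 𝒬) {φ : (ℕ → ℝ) → ℝ} (hφ : Measurable φ)
    (hLc : ∀ ε : ℝ≥0∞, 0 < ε → ∃ f : (ℕ → ℝ) →ᵇ ℝ, ∀ Q ∈ 𝒬,
      ∫⁻ x, edist (φ x) (f x) ∂(Q : Measure (ℕ → ℝ)) ≤ ε) :
    ∃ Y : ℕ → (ℕ → ℝ) → ℝ, (∀ k, ∃ n, Cyl n (Y k)) ∧ ∀ Q ∈ 𝒬, ∀ᵐ x ∂(Q : Measure (ℕ → ℝ)),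
      Tendsto (fun k => Y k x) atTop (𝓝 (φ x)) := by
  have happrox : ∀ k : ℕ, ∃ (n : ℕ) (Y : (ℕ → ℝ) → ℝ), Cyl n Y ∧ ∀ Q ∈ 𝒬,
      ∫⁻ x, edist (Y x) (φ x) ∂(Q : Measure (ℕ → ℝ)) ≤ ENNReal.ofReal (2 * 2⁻¹ ^ k) := fun k => by
    have hε : (0 : ℝ) < 2⁻¹ ^ k := by positivity
    obtain ⟨f, hf⟩ := hLc _ (ENNReal.ofReal_pos.2 hε)
    obtain ⟨n, Y, hY, hYf⟩ := exists_cyl_lintegral_edist_le h𝒬.isTightMeasureSet f hε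
    refine ⟨n, Y, hY, fun Q hQ => ?_⟩
    rw [two_mul, ENNReal.ofReal_add hε.le hε.le]
    refine (lintegral_edist_triangle (h := f) hY.measurable.aestronglyMeasurable
      f.continuous.aestronglyMeasurable).trans (add_le_add ?_ (hf Q hQ))
    simpa only [edist_comm] using hYf Q hQ
  choose n Y hY hYφ using happrox
  refine ⟨Y, fun k => ⟨n k, hY k⟩, fun Q hQ => ae_tendsto_of_tsum_lintegral_edist
    (fun k => ((hY k).measurable.edist hφ).aemeasurable) ?_⟩
  have hsum : Summable fun k : ℕ => 2 * (2⁻¹ : ℝ) ^ k :=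
    (summable_geometric_of_lt_one (by norm_num) (by norm_num)).mul_left 2
  exact ne_top_of_le_ne_top hsum.tsum_ofReal_ne_top (ENNReal.tsum_le_tsum fun k => hYφ k Q hQ)

end IIDFamily

/-! ### A countable family of bounded Lipschitz functions determining finite measures -/

section Determining

variable {E : Type*} [PseudoEMetricSpace E]

theorem bddLip_thickenedIndicator {δ : ℝ} (hδ : 0 < δ) (F : Set E) :
    BddLip fun x => (thickenedIndicator hδ F x : ℝ) :=
  ⟨⟨_, (LipschitzWith.subtype_val _).comp (lipschitzWith_thickenedIndicator hδ F)⟩, 1, fun x => by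
    rw [NNReal.abs_eq]
    exact_mod_cast thickenedIndicator_le_one hδ F x⟩

variable [MeasurableSpace E] [BorelSpace E]

theorem measure_eq_of_integral_thickenedIndicator_eq {μ ν : Measure E} [IsFiniteMeasure μ]
    [IsFiniteMeasure ν] {F : Set E} (hF : IsClosed F) {δ : ℕ → ℝ} (hδ : ∀ k, 0 < δ k)
    (hδ₀ : Tendsto δ atTop (𝓝 0))
    (h : ∀ k, ∫ x, (thickenedIndicator (hδ k) F x : ℝ) ∂μ =
      ∫ x, (thickenedIndicator (hδ k) F x : ℝ) ∂ν) : μ F = ν F := by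
  have hlim := fun (μ : Measure E) [IsFiniteMeasure μ] =>
    tendsto_lintegral_thickenedIndicator_of_isClosed μ hF hδ hδ₀
  refine tendsto_nhds_unique (hlim μ) ((hlim ν).congr fun k => ?_)
  have hfin := fun (μ : Measure E) [IsFiniteMeasure μ] =>
    ((thickenedIndicator (hδ k) F).lintegral_lt_top_of_nnreal μ).ne
  rw [← ENNReal.toReal_eq_toReal_iff' (hfin ν) (hfin μ)]
  simp only [BoundedContinuousFunction.toReal_lintegral_coe_eq_integral, h]

theorem exists_bddLip_determining (E : Type*) [PseudoEMetricSpace E] [SecondCountableTopology E]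
    [MeasurableSpace E] [BorelSpace E] :
    ∃ f : ℕ → E → ℝ, (∀ j, BddLip (f j)) ∧ ∀ (μ ν : Measure E) [IsFiniteMeasure μ]
      [IsFiniteMeasure ν], (∀ j, ∫ y, f j y ∂μ = ∫ y, f j y ∂ν) → μ = ν := by
  let 𝒟 : Set (Set (Set E)) := {s | s.Finite ∧ s ⊆ TopologicalSpace.countableBasis E}
  let C : Set (Set E) := (fun s => (⋃₀ s)ᶜ) '' 𝒟
  have hbasis := TopologicalSpace.isBasis_countableBasis E
  have hempty : ∅ ∈ 𝒟 := ⟨Set.finite_empty, Set.empty_subset _⟩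
  have hclosed : ∀ s ∈ 𝒟, IsClosed (⋃₀ s)ᶜ := fun s hs =>
    (isOpen_sUnion fun U hU => hbasis.isOpen (hs.2 hU)).isClosed_compl
  have hpi : IsPiSystem C := by
    rintro _ ⟨s, hs, rfl⟩ _ ⟨t, ht, rfl⟩ -
    refine ⟨s ∪ t, ⟨hs.1.union ht.1, Set.union_subset hs.2 ht.2⟩, ?_⟩
    simp only [Set.sUnion_union, Set.compl_union]
  have hgen : ‹MeasurableSpace E› = MeasurableSpace.generateFrom C := by
    refine le_antisymm ?_ (MeasurableSpace.generateFrom_le ?_)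
    · rw [BorelSpace.measurable_eq (α := E), hbasis.borel_eq_generateFrom]
      refine MeasurableSpace.generateFrom_le fun U hU => ?_
      have hUC : Uᶜ ∈ C := ⟨{U}, ⟨Set.finite_singleton U, Set.singleton_subset_iff.2 hU⟩, by
        simp only [Set.sUnion_singleton]⟩
      exact (MeasurableSpace.measurableSet_generateFrom hUC).of_compl
    · rintro _ ⟨s, hs, rfl⟩
      exact (hclosed s hs).measurableSet
  obtain ⟨e, he⟩ := (Set.countable_ofPred_finite_subset
    (TopologicalSpace.countable_countableBasis E)).exists_eq_range (s := 𝒟) ⟨∅, hempty⟩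
  have hδ : ∀ k : ℕ, 0 < 1 / ((k : ℝ) + 1) := fun k => Nat.one_div_pos_of_nat
  refine ⟨fun j => fun x => thickenedIndicator (hδ j.unpair.2) (⋃₀ e j.unpair.1)ᶜ x,
    fun j => bddLip_thickenedIndicator _ _, fun μ ν _ _ h => ?_⟩
  have hC : ∀ s ∈ 𝒟, μ (⋃₀ s)ᶜ = ν (⋃₀ s)ᶜ := fun s hs => by
    obtain ⟨a, rfl⟩ : s ∈ Set.range e := he ▸ hs
    refine measure_eq_of_integral_thickenedIndicator_eq (hclosed _ hs) hδ
      tendsto_one_div_add_atTop_nhds_zero_nat fun k => ?_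
    simpa only [Nat.unpair_pair] using h (a.pair k)
  refine ext_of_generate_finite C hgen hpi (Set.forall_mem_image.2 hC) ?_
  simpa only [Set.sUnion_empty, Set.compl_empty] using hC ∅ hempty

end Determining

/-! ### Steering the averages towards a target -/

/-- The control that compares the running average with the target `τ`. -/
def steer (τ : ∀ n, (Fin n → ℝ) → ℝ) (n : ℕ) (y : Fin n → ℝ) : ℝ :=
  clip 1 (τ n y - (∑ i, y i) / n)

theorem steer_restr (τ : ∀ n, (Fin n → ℝ) → ℝ) (n : ℕ) (x : ℕ → ℝ) :
    steer τ n (restr n x) = clip 1 (τ n (restr n x) - avg x n) := by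
  rw [steer, avg, ← Fin.sum_univ_eq_sum_range]
  rfl

theorem bddLip_steer {τ : ∀ n, (Fin n → ℝ) → ℝ} (hτ : ∀ n, BddLip (τ n)) (n : ℕ) :
    BddLip (steer τ n) := by
  obtain ⟨⟨K, hK⟩, -⟩ := hτ n
  let mean : (Fin n → ℝ) →L[ℝ] ℝ := (n : ℝ)⁻¹ • ∑ i, ContinuousLinearMap.proj i
  have hmean : ∀ y, mean y = (∑ i, y i) / n := fun y => by simp [mean, div_eq_inv_mul]
  have h := hK.sub mean.lipschitz
  simp only [hmean] at h
  exact BddLip.clip 1 h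

theorem clip_one_pos {z : ℝ} (hz : 0 < z) : 0 < clip 1 z :=
  lt_max_of_lt_right (lt_min hz one_pos)

theorem clip_one_neg {z : ℝ} (hz : z < 0) : clip 1 z < 0 :=
  max_lt (neg_lt_zero.2 one_pos) ((min_le_left _ _).trans_lt hz)

namespace IIDFamily

variable {𝒬 : Set (ProbabilityMeasure (ℕ → ℝ))} {Q : ProbabilityMeasure (ℕ → ℝ)} {d : ℕ}
  {L H : ℝ} {τ : ∀ n, (Fin n → ℝ) → ℝ}

theorem ae_tendsto_avg (h𝒬 : IIDFamily 𝒬) (hd : 1 ≤ d)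
    (hlo : Tendsto (fun n : ℕ => lowerMean 𝒬 n) atTop (𝓝 L))
    (hhi : Tendsto (fun n : ℕ => upperMean 𝒬 n) atTop (𝓝 H))
    (hτ : ∀ n, BddLip (τ n)) (hQ : Q ∈ 𝒬)
    (hD : ∀ n, d ≤ n → ∫ x, deficit 𝒬 (steer τ) n x ∂Q = 0) :
    ∀ᵐ x ∂(Q : Measure (ℕ → ℝ)), ∀ t ∈ Set.Icc L H,
      Tendsto (fun n => τ n (restr n x)) atTop (𝓝 t) → Tendsto (avg x) atTop (𝓝 t) := by
  have hnonneg : ∀ n, d ≤ n → ∀ s : (Fin n → ℝ) → ℝ, BddLip s → 0 ≤ ∫ x,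
      (gain (lowerMean 𝒬 n) (upperMean 𝒬 n) (s (restr n x)) - s (restr n x) * clip n (x n)) ∂Q :=
    fun n hn s hs => h𝒬.integral_gain_sub_nonneg (hd.trans hn) n hs hQ
  filter_upwards [ae_exists_drift (fun n => h𝒬.lowerMean_le_upperMean n) hnonneg
    (bddLip_steer hτ) hD (h𝒬.summable_integral_clip_sq_div hQ)
    (h𝒬.tsum_measure_lt_abs_ne_top hQ)] with x ⟨m, hm, hdrift⟩ t ht hxt
  have hdrift' := eventually_atTop.2 ⟨d, hdrift⟩
  simp only [steer_restr] at hdrift'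
  exact tendsto_avg_of_drift hm hlo hhi ht.1 ht.2 hxt (hdrift'.mono fun n h => h.1)
    (hdrift'.mono fun n h hlt => h.2.1 (clip_one_pos (sub_pos.2 hlt)))
    (hdrift'.mono fun n h hlt => h.2.2 (clip_one_neg (sub_neg.2 hlt)))

theorem exists_forall_exists_tendsto_avg (h𝒬 : IIDFamily 𝒬) (hLH : L ≤ H)
    (hlo : Tendsto (fun n : ℕ => lowerMean 𝒬 n) atTop (𝓝 L))
    (hhi : Tendsto (fun n : ℕ => upperMean 𝒬 n) atTop (𝓝 H)) (hd : 1 ≤ d)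
    {f : ℕ → (ℕ → ℝ) → ℝ} (hf : ∀ j, Cyl d (f j)) :
    ∃ Q₀ ∈ 𝒬, ∀ Y : ℕ → (ℕ → ℝ) → ℝ, (∀ k, ∃ n, Cyl n (Y k)) →
      ∃ Q ∈ 𝒬, (∀ j, ∫ x, f j x ∂Q = ∫ x, f j x ∂Q₀) ∧ ∀ᵐ x ∂(Q : Measure (ℕ → ℝ)), ∀ t,
        Tendsto (fun k => Y k x) atTop (𝓝 t) → Tendsto (avg x) atTop (𝓝 (max L (min t H))) := by
  obtain ⟨Q₀, hQ₀, hopt⟩ := h𝒬.exists_optimal hd hf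
  refine ⟨Q₀, hQ₀, fun Y hY => ?_⟩
  obtain ⟨τ, hτ, hYτ⟩ := exists_tendsto_restr_of_cyl hY
  have hτ' : ∀ n, BddLip fun y => max L (min (τ n y) H) := fun n =>
    BddLip.clamp L H (hτ n).1.choose_spec
  obtain ⟨Q, hQ, hmom, hD⟩ := hopt _ (bddLip_steer hτ')
  refine ⟨Q, hQ, hmom, ?_⟩
  filter_upwards [h𝒬.ae_tendsto_avg hd hlo hhi hτ' hQ hD] with x hx t ht
  exact hx _ ⟨le_max_left _ _, max_le hLH (min_le_right _ _)⟩
    (((lipschitzWith_clamp L H).continuous.tendsto t).comp (hYτ x t ht))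

theorem exists_tendsto_of_cyl_tendsto_ae (h𝒬 : IIDFamily 𝒬) (hLH : L ≤ H)
    (hlo : Tendsto (fun n : ℕ => lowerMean 𝒬 n) atTop (𝓝 L))
    (hhi : Tendsto (fun n : ℕ => upperMean 𝒬 n) atTop (𝓝 H)) {φ : (ℕ → ℝ) → ℝ}
    {Y : ℕ → (ℕ → ℝ) → ℝ} (hY : ∀ k, ∃ n, Cyl n (Y k))
    (hφ : ∀ Q ∈ 𝒬, ∀ᵐ x ∂(Q : Measure (ℕ → ℝ)), Tendsto (fun k => Y k x) atTop (𝓝 (φ x))) :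
    ∃ Q ∈ 𝒬, ∀ᵐ x ∂(Q : Measure (ℕ → ℝ)),
      Tendsto (avg x) atTop (𝓝 (max L (min (φ x) H))) := by
  obtain ⟨_, -, hopt⟩ := h𝒬.exists_forall_exists_tendsto_avg hLH hlo hhi le_rfl
    (f := fun _ _ => 0) fun _ => Cyl.const 0
  obtain ⟨Q, hQ, -, hlim⟩ := hopt Y hY
  refine ⟨Q, hQ, ?_⟩
  filter_upwards [hlim, hφ Q hQ] with x hx hxφ using hx _ hxφ

theorem exists_tendsto_of_measurable (h𝒬 : IIDFamily 𝒬) (hLH : L ≤ H)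
    (hlo : Tendsto (fun n : ℕ => lowerMean 𝒬 n) atTop (𝓝 L))
    (hhi : Tendsto (fun n : ℕ => upperMean 𝒬 n) atTop (𝓝 H)) (hd : 1 ≤ d)
    {φ : (Fin d → ℝ) → ℝ} (hφ : Measurable φ) :
    ∃ Q ∈ 𝒬, ∀ᵐ x ∂(Q : Measure (ℕ → ℝ)),
      Tendsto (avg x) atTop (𝓝 (max L (min (φ (restr d x)) H))) := by
  obtain ⟨f, hf, hdet⟩ := exists_bddLip_determining (Fin d → ℝ)
  obtain ⟨Q₀, -, hopt⟩ := h𝒬.exists_forall_exists_tendsto_avg hLH hlo hhi hd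
    fun j => Cyl.comp_restr (hf j)
  have hr := measurable_restr d
  obtain ⟨g, hg, hgφ⟩ := exists_bddLip_tendsto_ae ((Q₀ : Measure (ℕ → ℝ)).map (restr d)) <|
    Integrable.of_mem_Icc L H (measurable_const.max (hφ.min measurable_const)).aemeasurable <|
      .of_forall fun y => ⟨le_max_left _ _, max_le hLH (min_le_right _ _)⟩
  obtain ⟨Q, hQ, hmom, hlim⟩ := hopt _ fun k => ⟨d, Cyl.comp_restr (hg k)⟩
  have hlaw : (Q : Measure (ℕ → ℝ)).map (restr d) = (Q₀ : Measure (ℕ → ℝ)).map (restr d) :=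
    hdet _ _ fun j => by
      have hfj := (hf j).continuous.stronglyMeasurable
      rw [integral_map hr.aemeasurable hfj.aestronglyMeasurable,
        integral_map hr.aemeasurable hfj.aestronglyMeasurable, hmom j]
  rw [← hlaw] at hgφ
  refine ⟨Q, hQ, ?_⟩
  filter_upwards [hlim, ae_of_ae_map hr.aemeasurable hgφ] with x hx hxφ
  simpa only [min_eq_left (max_le hLH (min_le_right _ _)), le_max_left, sup_of_le_right]
    using hx _ hxφ

end IIDFamily

/-! ### From the sub-linear expectation to the laws of the sequence -/

namespace BddLip

theorem locLip {n : ℕ} {h : (Fin n → ℝ) → ℝ} (hh : BddLip h) : LocLip h := by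
  obtain ⟨K, -, hK, -, hdist, -⟩ := hh.exists_bounds
  refine ⟨K + 1, 0, by linarith, fun x y => (hdist x y).trans ?_⟩
  rw [dist_eq_norm]
  simp only [pow_zero]
  nlinarith [norm_nonneg (x - y)]

theorem ciSup {ι E : Type*} [Nonempty ι] [PseudoMetricSpace E] {F : ι → E → ℝ} {K M : ℝ}
    (hK : ∀ i x y, |F i x - F i y| ≤ K * dist x y) (hM : ∀ i x, |F i x| ≤ M) :
    BddLip fun x => ⨆ i, F i x := by
  have hbdd : ∀ x, BddAbove (Set.range fun i => F i x) := fun x =>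
    ⟨M, Set.forall_mem_range.2 fun i => (abs_le.1 (hM i x)).2⟩
  have hsub : ∀ x y, (⨆ i, F i x) - ⨆ i, F i y ≤ K * dist x y := fun x y => by
    rw [sub_le_iff_le_add]
    refine ciSup_le fun i => ?_
    linarith [(abs_le.1 (hK i x y)).2, le_ciSup (hbdd y) i]
  refine .of_dist_le (K := K) (M := M) (fun x y => abs_sub_le_iff.2 ⟨hsub x y, ?_⟩) fun x => ?_
  · rw [dist_comm]
    exact hsub y x
  · obtain ⟨i⟩ := ‹Nonempty ι›
    exact abs_le.2 ⟨(abs_le.1 (hM i x)).1.trans (le_ciSup (hbdd x) i),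
      ciSup_le fun i => (abs_le.1 (hM i x)).2⟩

theorem exists_indicator_le {a b : ℝ} (hab : a < b) :
    ∃ ℓ : ℝ → ℝ, BddLip ℓ ∧ (Set.Ici b).indicator 1 ≤ ℓ ∧ ℓ ≤ (Set.Ici a).indicator 1 := by
  have hlip : LipschitzWith ‖(b - a)⁻¹‖₊ fun t : ℝ => (t - a) * (b - a)⁻¹ :=
    .of_dist_le_mul fun x y => by
      rw [Real.dist_eq, ← sub_mul, sub_sub_sub_cancel_right, abs_mul, mul_comm, coe_nnnorm,
        Real.norm_eq_abs, Real.dist_eq]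
  have hba : 0 < b - a := sub_pos.2 hab
  refine ⟨_, .clamp 0 1 hlip, fun t => ?_, fun t => ?_⟩
  · refine Set.indicator_apply_le' (fun ht => ?_) fun _ => le_max_left _ _
    refine le_max_of_le_right (le_min ?_ le_rfl)
    rw [← div_eq_mul_inv, Pi.one_apply, one_le_div hba]
    exact sub_le_sub_right ht a
  · refine Set.le_indicator_apply (fun _ => max_le zero_le_one (min_le_right _ _)) fun ht => ?_
    refine max_le le_rfl ((min_le_left _ _).trans (mul_nonpos_of_nonpos_of_nonneg ?_ ?_))
    exacts [sub_nonpos.2 (not_le.1 ht).le, inv_nonneg.2 hba.le]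

end BddLip

theorem ofReal_mul_tsum_le_lintegral_Ioi {V : ℝ → ℝ≥0∞} (hV : Antitone V) {δ : ℝ} (hδ : 0 ≤ δ) :
    ENNReal.ofReal δ * ∑' k : ℕ, V ((k + 1 : ℕ) * δ) ≤ ∫⁻ t in Set.Ioi 0, V t := by
  have hmono : Monotone fun k : ℕ => (k : ℝ) * δ := Nat.mono_cast.mul_const hδ
  rw [← ENNReal.tsum_mul_left]
  calc ∑' k : ℕ, ENNReal.ofReal δ * V ((k + 1 : ℕ) * δ)
      ≤ ∑' k : ℕ, ∫⁻ t in Set.Ioc (k * δ) ((k + 1 : ℕ) * δ), V t := by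
        refine ENNReal.tsum_le_tsum fun k => ?_
        calc ENNReal.ofReal δ * V ((k + 1 : ℕ) * δ)
            = ∫⁻ _ in Set.Ioc (k * δ) ((k + 1 : ℕ) * δ), V ((k + 1 : ℕ) * δ) := by
              rw [setLIntegral_const, Real.volume_Ioc, mul_comm, ← sub_mul, Nat.cast_succ,
                add_sub_cancel_left, one_mul]
          _ ≤ _ := setLIntegral_mono' measurableSet_Ioc fun t ht => hV ht.2
    _ = ∫⁻ t in ⋃ k : ℕ, Set.Ioc (k * δ) ((k + 1 : ℕ) * δ), V t :=
        (lintegral_iUnion (fun _ => measurableSet_Ioc) hmono.pairwise_disjoint_on_Ioc_succ _).symm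
    _ ≤ ∫⁻ t in Set.Ioi 0, V t := lintegral_mono_set <| Set.iUnion_subset fun k t ht =>
        (mul_nonneg k.cast_nonneg hδ).trans_lt ht.1

theorem abs_integral_le_of_abs_le {α : Type*} [MeasurableSpace α] {μ : Measure α}
    [IsProbabilityMeasure μ] {f : α → ℝ} {M : ℝ} (hM : ∀ x, |f x| ≤ M) : |∫ x, f x ∂μ| ≤ M := by
  simpa only [Real.norm_eq_abs, probReal_univ, mul_one] using
    norm_integral_le_of_norm_le_const (μ := μ) (f := f) (.of_forall hM)

theorem upE_eq_coe_iSup {𝒬 : Set (ProbabilityMeasure (ℕ → ℝ))} (h𝒬 : 𝒬.Nonempty)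
    {Z : (ℕ → ℝ) → ℝ} {M : ℝ} (hM : ∀ x, |Z x| ≤ M) :
    (upE 𝒬 Z : EReal) = ⨆ Q ∈ 𝒬, ((∫ x, Z x ∂Q : ℝ) : EReal) := by
  have := h𝒬.to_subtype
  have hbdd : BddAbove (Set.range fun Q : 𝒬 => ∫ x, Z x ∂(Q : ProbabilityMeasure (ℕ → ℝ))) :=
    ⟨M, Set.forall_mem_range.2 fun Q =>
      (le_abs_self _).trans (abs_integral_le_of_abs_le hM)⟩
  rw [iSup_subtype', upE]
  exact EReal.coe_strictMono.monotone.map_ciSup_of_continuousAt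
    continuous_coe_real_ereal.continuousAt hbdd

theorem bddLip_upE {E : Type*} [PseudoMetricSpace E] {𝒬 : Set (ProbabilityMeasure (ℕ → ℝ))}
    (h𝒬 : 𝒬.Nonempty) {φ : E × ℝ → ℝ} (hφ : BddLip φ) (n : ℕ) :
    BddLip fun a => upE 𝒬 fun x => φ (a, x n) := by
  have := h𝒬.to_subtype
  obtain ⟨K, M, -, -, hK, hM⟩ := hφ.exists_bounds
  have hint : ∀ a (Q : ProbabilityMeasure (ℕ → ℝ)),
      Integrable (fun x => φ (a, x n)) (Q : Measure (ℕ → ℝ)) := fun a Q =>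
    .of_bound (hφ.continuous.comp (Continuous.prodMk_right a |>.comp
      (continuous_apply n))).measurable.aestronglyMeasurable M (.of_forall fun _ => hM _)
  refine .ciSup (K := K) (M := M) (fun Q a b => ?_) fun Q a => ?_
  · rw [← integral_sub (hint a Q) (hint b Q)]
    refine abs_integral_le_of_abs_le fun x => (hK _ _).trans_eq ?_
    rw [Prod.dist_eq, dist_self, max_eq_left dist_nonneg]
  · exact abs_integral_le_of_abs_le fun x => hM _

theorem cyl_pair {n : ℕ} {φ : (Fin n → ℝ) × ℝ → ℝ} (hφ : BddLip φ) :
    Cyl (n + 1) fun x => φ (restr n x, x n) := by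
  have hlip : LipschitzWith 1 fun y : Fin (n + 1) → ℝ =>
      (fun j => y (Fin.castSucc j), y (.last n)) :=
    LipschitzWith.of_dist_le_mul fun y z => by
      rw [NNReal.coe_one, one_mul, Prod.dist_eq]
      exact max_le ((dist_pi_le_iff dist_nonneg).2 fun j => dist_le_pi_dist y z _)
        (dist_le_pi_dist y z _)
  exact .comp_restr (hφ.comp hlip)

theorem limEvent_clamp {Ω : Type*} {X : ℕ → Ω → ℝ} {L H : ℝ} (hLH : L ≤ H) (Z : Ω → ℝ) :
    limEvent X L H (fun ω => max L (min (Z ω) H)) = limEvent X L H Z := by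
  have hidem : ∀ z : ℝ, max L (min (max L (min z H)) H) = max L (min z H) := fun z => by
    rw [min_eq_left (max_le hLH (min_le_right z H)), max_eq_right (le_max_left _ _)]
  simp only [limEvent, hidem]

namespace SubLinSpace

variable {Ω : Type*} [MeasurableSpace Ω] {S : SubLinSpace Ω} {X : ℕ → Ω → ℝ} {Pfam : Set S.Prob}
  {P : S.Prob} {L H : ℝ}

theorem measurable_sigma {Y : Ω → ℝ} (hY : Y ∈ S.H) : Measurable[S.sigma] Y := by
  rw [measurable_iff_comap_le, BorelSpace.measurable_eq (α := ℝ)]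
  exact le_iSup₂ (f := fun (Y : Ω → ℝ) (_ : Y ∈ S.H) => MeasurableSpace.comap Y (borel ℝ)) Y hY

theorem measurable_seq_sigma (hX : ∀ n, X n ∈ S.H) : Measurable[S.sigma] fun ω n => X n ω :=
  @measurable_pi_lambda _ _ _ S.sigma _ _ fun n => measurable_sigma (hX n)

theorem comp_mem_Hb {n : ℕ} {Y : Fin n → Ω → ℝ} (hY : ∀ i, Y i ∈ S.H) {h : (Fin n → ℝ) → ℝ}
    (hh : BddLip h) : (fun ω => h fun i => Y i ω) ∈ S.Hb :=
  ⟨S.comp_mem n Y hY h hh.locLip, hh.2.imp fun _ hM _ => hM _⟩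

theorem const_mem_Hb (c : ℝ) : (fun _ : Ω => c) ∈ S.Hb :=
  comp_mem_Hb (Y := Fin.elim0) (fun i => i.elim0) (.const c)

theorem comp_apply_mem_Hb {Y : Ω → ℝ} (hY : Y ∈ S.H) {ℓ : ℝ → ℝ} (hℓ : BddLip ℓ) :
    (fun ω => ℓ (Y ω)) ∈ S.Hb :=
  comp_mem_Hb (n := 1) (Y := fun _ => Y) (fun _ => hY) (hℓ.comp (LipschitzWith.eval 0))

theorem cyl_comp_mem_Hb (hX : ∀ n, X n ∈ S.H) {n : ℕ} {Z : (ℕ → ℝ) → ℝ} (hZ : Cyl n Z) :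
    (fun ω => Z fun i => X i ω) ∈ S.Hb := by
  obtain ⟨h, hh, hZ⟩ := hZ
  simp only [hZ]
  exact comp_mem_Hb (Y := fun i : Fin n => X i) (fun i => hX i) hh

variable (S) in
/-- `P` is dominated by the sub-linear expectation on the bounded random variables, as the measure
`Q` of part (a) has to be. -/
def Dominates (P : S.Prob) : Prop := ∀ Y ∈ S.Hb, ((∫ ω, Y ω ∂P.1 : ℝ) : EReal) ≤ S.E Y

theorem Dominates.measure_le (hP : S.Dominates P) {Y : Ω → ℝ} (hY : Y ∈ S.Hb) {B : Set Ω}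
    (hB : B.indicator 1 ≤ Y) : P.1 B ≤ (S.E Y).toENNReal := by
  have := P.2
  obtain ⟨M, hM⟩ := hY.2
  have hm : Measurable[S.sigma] Y := measurable_sigma hY.1
  have hY0 : 0 ≤ Y :=
    fun ω => (Set.indicator_nonneg (fun _ _ => zero_le_one) ω).trans (hB ω)
  have hint : Integrable Y P.1 := .of_bound hm.aestronglyMeasurable M (.of_forall hM)
  calc P.1 B ≤ 1 * P.1 {ω | 1 ≤ ENNReal.ofReal (Y ω)} := by
        rw [one_mul]
        refine measure_mono fun ω hω => ENNReal.one_le_ofReal.2 ?_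
        simpa only [Set.indicator_of_mem hω, Pi.one_apply] using hB ω
    _ ≤ ∫⁻ ω, ENNReal.ofReal (Y ω) ∂P.1 := mul_meas_ge_le_lintegral hm.ennreal_ofReal 1
    _ = ENNReal.ofReal (∫ ω, Y ω ∂P.1) :=
        (ofReal_integral_eq_lintegral_ofReal hint (.of_forall hY0)).symm
    _ ≤ (S.E Y).toENNReal := EReal.toENNReal_le_toENNReal (hP Y hY)

/-! ### Capacities -/

theorem upCap_mono {A B : Set Ω} (h : A ⊆ B) : S.upCap A ≤ S.upCap B :=
  le_iInf₂ fun ξ hξ => le_iInf fun hBξ => iInf₂_le_of_le ξ hξ <| iInf_le_of_le (fun ω =>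
    (Set.indicator_le_indicator_of_subset h (fun _ => zero_le_one) ω).trans (hBξ ω)) le_rfl

theorem upCap_le_one (A : Set Ω) : S.upCap A ≤ 1 := by
  refine iInf₂_le_of_le (fun _ => 1) (const_mem_Hb 1).1 <| iInf_le_of_le
    (Set.indicator_le_self' fun _ _ => zero_le_one) ?_
  rw [S.const, EReal.real_coe_toENNReal, ENNReal.ofReal_one]

theorem upCap_empty : S.upCap ∅ = 0 := by
  refine le_antisymm (iInf₂_le_of_le (fun _ => 0) (const_mem_Hb 0).1 <| iInf_le_of_le
    (fun _ => by rw [Set.indicator_empty]) ?_) bot_le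
  rw [S.const, EReal.real_coe_toENNReal, ENNReal.ofReal_zero]

theorem toENNReal_E_le_upCap {Y : Ω → ℝ} (hY : Y ∈ S.H) {A : Set Ω} (hA : Y ≤ A.indicator 1) :
    (S.E Y).toENNReal ≤ S.upCap A :=
  le_iInf₂ fun ξ hξ => le_iInf fun hAξ =>
    EReal.toENNReal_le_toENNReal (S.mono ξ hξ Y hY (hA.trans hAξ))

theorem upCap_univ : S.upCap Set.univ = 1 := by
  refine le_antisymm (upCap_le_one _) ?_
  have h := toENNReal_E_le_upCap (S := S) (const_mem_Hb 1).1 (A := Set.univ)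
    (by rw [Set.indicator_univ]; rfl)
  rwa [S.const, EReal.real_coe_toENNReal, ENNReal.ofReal_one] at h

theorem Dominates.measure_le_upCap (hP : S.Dominates P) (B : Set Ω) : P.1 B ≤ S.upCap B := by
  refine le_iInf₂ fun ξ hξ => le_iInf fun hBξ => ?_
  have hclip : (fun ω => clip 1 (ξ ω)) ∈ S.Hb := comp_apply_mem_Hb hξ (.clip 1 LipschitzWith.id)
  have hξ0 : ∀ ω, 0 ≤ ξ ω := fun ω =>
    (Set.indicator_nonneg (fun _ _ => zero_le_one) ω).trans (hBξ ω)
  refine (hP.measure_le hclip ?_).trans <| EReal.toENNReal_le_toENNReal <|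
    S.mono ξ hξ _ hclip.1 fun ω => max_le (by linarith [hξ0 ω]) (min_le_left _ _)
  exact fun ω => le_max_of_le_right
    (le_min (hBξ ω) (Set.indicator_le_self' (fun _ _ => zero_le_one) ω))

theorem outCap_le_one (A : Set Ω) : S.outCap A ≤ 1 := by
  refine iInf₂_le_of_le (fun n => if n = 0 then Set.univ else ∅) (fun n => ?_) <|
    iInf_le_of_le (fun ω _ => Set.mem_iUnion.2 ⟨0, Set.mem_univ ω⟩) ?_
  · dsimp only
    split_ifs
    exacts [.univ, .empty]
  · rw [tsum_eq_single 0 fun n hn => by simp only [if_neg hn, upCap_empty]]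
    exact upCap_le_one _

theorem Dominates.outCap_eq_one (hP : S.Dominates P) {A : Set Ω} (hA : P.1 A = 1) :
    S.outCap A = 1 := by
  refine le_antisymm (outCap_le_one A) (le_iInf₂ fun B _ => le_iInf fun hAB => ?_)
  calc 1 = P.1 A := hA.symm
    _ ≤ P.1 (⋃ n, B n) := measure_mono hAB
    _ ≤ ∑' n, P.1 (B n) := measure_iUnion_le B
    _ ≤ ∑' n, S.upCap (B n) := ENNReal.tsum_le_tsum fun n => hP.measure_le_upCap (B n)

theorem lintegral_upCap_ne_top {Y : Ω → ℝ} (hY : 0 ≤ Y) (h : choquet S.upCap Y < ⊤) :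
    ∫⁻ t in Set.Ioi (0 : ℝ), S.upCap {ω | t ≤ Y ω} ≠ ∞ := by
  have hneg : ∫⁻ t in Set.Iio (0 : ℝ), (1 - S.upCap {ω | t ≤ Y ω}) = 0 := by
    refine (setLIntegral_congr_fun measurableSet_Iio fun t ht => ?_).trans lintegral_zero
    have huniv : {ω | t ≤ Y ω} = Set.univ := Set.eq_univ_of_forall fun ω => ht.le.trans (hY ω)
    rw [huniv, upCap_univ, tsub_self]
  rw [choquet, hneg, EReal.coe_ennreal_zero, sub_zero] at h
  exact fun htop => h.ne (by rw [htop, EReal.coe_ennreal_top])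

theorem summable_upCap {Y : Ω → ℝ} (hY : 0 ≤ Y) (h : choquet S.upCap Y < ⊤) {δ : ℝ} (hδ : 0 < δ) :
    Summable fun k : ℕ => (S.upCap {ω | k * δ ≤ Y ω}).toReal := by
  have hle := ofReal_mul_tsum_le_lintegral_Ioi (V := fun t => S.upCap {ω | t ≤ Y ω})
    (fun s t hst => upCap_mono fun ω hω => hst.trans hω) hδ.le
  refine (summable_nat_add_iff 1).1 (ENNReal.summable_toReal fun htop => ?_)
  rw [htop, ENNReal.mul_top (ENNReal.ofReal_pos.2 hδ).ne', top_le_iff] at hle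
  exact lintegral_upCap_ne_top hY h hle

theorem IsIID.measure_le_upCap (hX : S.IsIID X) (hP : S.Dominates P) {a b : ℝ} (hab : a < b)
    (n : ℕ) : P.1 {ω | b ≤ |X n ω|} ≤ S.upCap {ω | a ≤ |X 0 ω|} := by
  obtain ⟨ℓ, hℓ, hbℓ, hℓa⟩ := BddLip.exists_indicator_le hab
  have habs : BddLip fun t => ℓ |t| := hℓ.comp lipschitzWith_one_norm
  have hmem : ∀ j, (fun ω => ℓ |X j ω|) ∈ S.Hb := fun j => comp_apply_mem_Hb (hX.mem j) habs
  calc P.1 {ω | b ≤ |X n ω|} ≤ (S.E fun ω => ℓ |X n ω|).toENNReal :=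
        hP.measure_le (hmem n) fun ω => hbℓ |X n ω|
    _ = (S.E fun ω => ℓ |X 0 ω|).toENNReal :=
        congrArg _ (hX.ident n (fun y => ℓ |y 0|) (habs.comp (LipschitzWith.eval 0)))
    _ ≤ S.upCap {ω | a ≤ |X 0 ω|} := toENNReal_E_le_upCap (hmem 0).1 fun ω => hℓa |X 0 ω|

/-! ### The laws of the sequence -/

/-- The law of the sequence `X` under `P`. -/
def seqLaw (hX : ∀ n, X n ∈ S.H) (P : S.Prob) : ProbabilityMeasure (ℕ → ℝ) :=
  @ProbabilityMeasure.map Ω (ℕ → ℝ) S.sigma _ P _ (measurable_seq_sigma hX).aemeasurable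

theorem integral_seqLaw (hX : ∀ n, X n ∈ S.H) (P : S.Prob) {Z : (ℕ → ℝ) → ℝ} (hZ : Measurable Z) :
    ∫ x, Z x ∂(seqLaw hX P) = ∫ ω, Z (fun n => X n ω) ∂P.1 :=
  integral_map (measurable_seq_sigma hX).aemeasurable hZ.aestronglyMeasurable

theorem lintegral_seqLaw (hX : ∀ n, X n ∈ S.H) (P : S.Prob) {Z : (ℕ → ℝ) → ℝ≥0∞}
    (hZ : Measurable Z) :
    ∫⁻ x, Z x ∂(seqLaw hX P : Measure (ℕ → ℝ)) = ∫⁻ ω, Z (fun n => X n ω) ∂P.1 :=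
  @lintegral_map _ _ S.sigma _ P.1 _ _ hZ (measurable_seq_sigma hX)

theorem seqLaw_apply (hX : ∀ n, X n ∈ S.H) (P : S.Prob) {A : Set (ℕ → ℝ)} (hA : MeasurableSet A) :
    (seqLaw hX P : Measure (ℕ → ℝ)) A = P.1 {ω | (fun n => X n ω) ∈ A} :=
  Measure.map_apply (measurable_seq_sigma hX) hA

theorem measure_limEvent_eq_one (hX : ∀ n, X n ∈ S.H) {lo hi : ℝ} {φ : (ℕ → ℝ) → ℝ}
    (h : ∀ᵐ x ∂(seqLaw hX P : Measure (ℕ → ℝ)),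
      Tendsto (avg x) atTop (𝓝 (max lo (min (φ x) hi)))) :
    P.1 (limEvent X lo hi fun ω => φ fun i => X i ω) = 1 := by
  have := P.2
  rw [← measure_univ (μ := P.1)]
  exact measure_congr <| eventuallyEq_univ.2 <|
    ae_of_ae_map (measurable_seq_sigma hX).aemeasurable h

namespace CC

theorem dominates (hCC : S.CC Pfam) (hP : P ∈ Pfam) : S.Dominates P := fun Y hY => by
  rw [hCC.repr Y hY]
  exact le_iSup₂ (f := fun (P : S.Prob) (_ : P ∈ Pfam) => ((∫ ω, Y ω ∂P.1 : ℝ) : EReal)) P hP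

theorem nonempty (hCC : S.CC Pfam) : Pfam.Nonempty := by
  by_contra h
  have hbot := hCC.repr _ (const_mem_Hb 0)
  simp only [Set.not_nonempty_iff_eq_empty.1 h, Set.mem_empty_iff_false, iSup_false, iSup_bot,
    S.const] at hbot
  exact EReal.coe_ne_bot 0 hbot

theorem E_cyl (hCC : S.CC Pfam) (hX : ∀ n, X n ∈ S.H) {n : ℕ} {Z : (ℕ → ℝ) → ℝ} (hZ : Cyl n Z) :
    S.E (fun ω => Z fun i => X i ω) = (upE (seqLaw hX '' Pfam) Z : EReal) := by
  obtain ⟨M, hM⟩ : ∃ M, ∀ x, |Z x| ≤ M := by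
    obtain ⟨h, ⟨-, M, hM⟩, hZ⟩ := hZ
    exact ⟨M, fun x => by rw [hZ]; exact hM _⟩
  rw [hCC.repr _ (cyl_comp_mem_Hb hX hZ), upE_eq_coe_iSup (hCC.nonempty.image _) hM, iSup_image]
  simp only [integral_seqLaw hX _ hZ.measurable]

theorem isCompact_seqLaw (hCC : S.CC Pfam) {Y : ℕ → Ω → ℝ} (hY : ∀ n, Y n ∈ S.Hb) :
    IsCompact (seqLaw (fun n => (hY n).1) '' Pfam) := by
  convert hCC.compact Y hY using 1
  ext ν
  refine exists_congr fun P => and_congr_right fun _ => ⟨?_, fun hν => ?_⟩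
  · rintro rfl A hA
    exact seqLaw_apply _ P hA
  · refine Subtype.ext (Measure.ext fun A hA => ?_)
    exact (seqLaw_apply _ P hA).trans (hν A hA).symm

theorem isCompact_moments (hCC : S.CC Pfam) (hX : ∀ n, X n ∈ S.H) {Z : ℕ → (ℕ → ℝ) → ℝ}
    (hZ : ∀ j, ∃ n, Cyl n (Z j)) :
    IsCompact ((fun (Q : ProbabilityMeasure (ℕ → ℝ)) (j : ℕ) => ∫ x, Z j x ∂Q) ''
      (seqLaw hX '' Pfam)) := by
  have hmem : ∀ j, (fun ω => Z j fun i => X i ω) ∈ S.Hb := fun j =>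
    (hZ j).elim fun _ hn => cyl_comp_mem_Hb hX hn
  have hmeas : ∀ j, Measurable (Z j) := fun j => (hZ j).elim fun _ hn => hn.measurable
  choose M hM using fun j => (hmem j).2
  -- Moments of unbounded coordinates are not weakly continuous; clipping does not affect `Z j`.
  let b : ℕ → (ℕ → ℝ) →ᵇ ℝ := fun j => .ofNormedAddCommGroup (fun y => clip |M j| (y j))
    ((continuous_clip _).comp (continuous_apply j)) |M j| fun y => abs_clip_le (abs_nonneg _) _
  have hb : ∀ P j, ∫ y, b j y ∂(seqLaw (fun j => (hmem j).1) P) = ∫ x, Z j x ∂(seqLaw hX P) :=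
    fun P j => by
      rw [integral_seqLaw _ P (b j).continuous.measurable, integral_seqLaw hX P (hmeas j)]
      exact integral_congr_ae (.of_forall fun ω =>
        clip_eq_self ((hM j ω).trans (le_abs_self _)))
  have hcompact := (hCC.isCompact_seqLaw hmem).image
    (f := fun (ν : ProbabilityMeasure (ℕ → ℝ)) (j : ℕ) => ∫ y, b j y ∂(ν : Measure (ℕ → ℝ)))
    (continuous_pi fun j =>
      ProbabilityMeasure.continuous_integral_boundedContinuousFunction (b j))
  rw [Set.image_image] at hcompact ⊢
  simpa only [hb] using hcompact

theorem indep_laws (hCC : S.CC Pfam) (hX : S.IsIID X) (i : ℕ)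
    {φ : (Fin (i + 1) → ℝ) × ℝ → ℝ} (hφ : BddLip φ) :
    upE (seqLaw hX.mem '' Pfam) (fun x => φ (restr (i + 1) x, x (i + 1))) =
      upE (seqLaw hX.mem '' Pfam)
        (fun x => upE (seqLaw hX.mem '' Pfam) fun y => φ (restr (i + 1) x, y 0)) := by
  have hφa : ∀ a, BddLip fun t : Fin 1 → ℝ => φ (a, t 0) := fun a =>
    hφ.comp ((LipschitzWith.const a).prodMk (LipschitzWith.eval (0 : Fin 1)))
  have hinner : ∀ a, S.E (fun ω => φ (a, X (i + 1) ω)) =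
      (upE (seqLaw hX.mem '' Pfam) fun y => φ (a, y 0) : ℝ) := fun a =>
    (hX.ident (i + 1) _ (hφa a)).trans (hCC.E_cyl hX.mem (Cyl.comp_restr (n := 1) (hφa a)))
  have houter : Cyl (i + 1) fun x =>
      upE (seqLaw hX.mem '' Pfam) fun y => φ (restr (i + 1) x, y 0) :=
    .comp_restr (bddLip_upE (hCC.nonempty.image _) hφ 0)
  have hindep := hX.indep i (fun p => φ (p.1, p.2 0)) <|
    hφ.comp (LipschitzWith.prod_fst.prodMk ((LipschitzWith.eval 0).comp LipschitzWith.prod_snd))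
  simp only [hinner, EReal.toReal_coe] at hindep
  exact EReal.coe_injective <|
    (hCC.E_cyl hX.mem (cyl_pair hφ)).symm.trans (hindep.trans (hCC.E_cyl hX.mem houter))

theorem tail_laws (hCC : S.CC Pfam) (hX : S.IsIID X)
    (hmoment : choquet S.upCap (fun ω => |X 0 ω|) < ⊤) :
    ∃ w : ℕ → ℝ, (∀ k, 0 ≤ w k) ∧ Summable w ∧ ∀ Q ∈ seqLaw hX.mem '' Pfam, ∀ n k : ℕ,
      (Q : Measure (ℕ → ℝ)) {x | (k : ℝ) ≤ |x n|} ≤ ENNReal.ofReal (w k) := by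
  refine ⟨_, fun k => ENNReal.toReal_nonneg,
    summable_upCap (fun ω => abs_nonneg (X 0 ω)) hmoment one_half_pos, ?_⟩
  rintro _ ⟨P, hP, rfl⟩ n k
  rw [ENNReal.ofReal_toReal (ne_top_of_le_ne_top ENNReal.one_ne_top (upCap_le_one _))]
  rcases k.eq_zero_or_pos with rfl | hk
  · have huniv : {ω | ((0 : ℕ) : ℝ) * (1 / 2) ≤ |X 0 ω|} = Set.univ :=
      Set.eq_univ_of_forall fun ω => by simp
    rw [huniv, upCap_univ]
    exact prob_le_one
  · rw [seqLaw_apply _ _ (measurableSet_le measurable_const (measurable_pi_apply n).abs)]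
    refine hX.measure_le_upCap (hCC.dominates hP) ?_ n
    linarith [Nat.cast_pos (α := ℝ).2 hk]

theorem iidFamily (hCC : S.CC Pfam) (hX : S.IsIID X)
    (hmoment : choquet S.upCap (fun ω => |X 0 ω|) < ⊤) : IIDFamily (seqLaw hX.mem '' Pfam) where
  nonempty := hCC.nonempty.image _
  compact _ hY := hCC.isCompact_moments hX.mem hY
  indep i _ hφ := hCC.indep_laws hX i hφ
  tail := hCC.tail_laws hX hmoment

theorem exists_isTruncMean (hCC : S.CC Pfam) (hX : S.IsIID X)
    (hmoment : choquet S.upCap (fun ω => |X 0 ω|) < ⊤) :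
    ∃ L H : ℝ, L ≤ H ∧ S.IsTruncMean (X 0) H ∧ S.IsTruncMean (fun ω => -X 0 ω) (-L) ∧
      Tendsto (fun n : ℕ => lowerMean (seqLaw hX.mem '' Pfam) n) atTop (𝓝 L) ∧
      Tendsto (fun n : ℕ => upperMean (seqLaw hX.mem '' Pfam) n) atTop (𝓝 H) := by
  have h𝒬 := hCC.iidFamily hX hmoment
  have hclip : ∀ s c, Cyl 1 fun x => s * clip c (x 0) := fun s c =>
    (Cyl.clip_apply c zero_lt_one).const_mul s
  obtain ⟨H, hH⟩ := h𝒬.exists_tendsto_upE_mul_clip 1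
  obtain ⟨L, hL⟩ : ∃ L : ℝ, Tendsto (fun c => upE (seqLaw hX.mem '' Pfam) fun x =>
      -1 * clip c (x 0)) atTop (𝓝 (-L)) :=
    (h𝒬.exists_tendsto_upE_mul_clip (-1)).imp' Neg.neg fun m hm => by rwa [neg_neg]
  have hEH := (EReal.tendsto_coe.2 hH).congr fun c => (hCC.E_cyl hX.mem (hclip 1 c)).symm
  have hEL := (EReal.tendsto_coe.2 hL).congr fun c => (hCC.E_cyl hX.mem (hclip (-1) c)).symm
  simp only [one_mul] at hH hEH
  simp only [neg_one_mul] at hL hEL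
  have hhi : Tendsto (fun n : ℕ => upperMean (seqLaw hX.mem '' Pfam) n) atTop (𝓝 H) :=
    hH.comp tendsto_natCast_atTop_atTop
  have hlo : Tendsto (fun n : ℕ => lowerMean (seqLaw hX.mem '' Pfam) n) atTop (𝓝 L) :=
    neg_neg L ▸ (hL.comp tendsto_natCast_atTop_atTop).neg
  refine ⟨L, H, le_of_tendsto_of_tendsto' hlo hhi fun n => h𝒬.lowerMean_le_upperMean n, hEH,
    hEL.congr' ?_, hlo, hhi⟩
  filter_upwards [eventually_ge_atTop 0] with c hc
  simp only [← clip_neg hc]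
  rfl

theorem exists_limEvent_of_measurable (hCC : S.CC Pfam) (hX : S.IsIID X)
    (hmoment : choquet S.upCap (fun ω => |X 0 ω|) < ⊤) (hLH : L ≤ H)
    (hlo : Tendsto (fun n : ℕ => lowerMean (seqLaw hX.mem '' Pfam) n) atTop (𝓝 L))
    (hhi : Tendsto (fun n : ℕ => upperMean (seqLaw hX.mem '' Pfam) n) atTop (𝓝 H))
    {d : ℕ} {φ : (Fin d → ℝ) → ℝ} (hφ : Measurable φ) :
    ∃ P ∈ Pfam, P.1 (limEvent X L H fun ω => φ fun i => X i ω) = 1 := by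
  have hφ' : Measurable fun y : Fin (d + 1) → ℝ => φ fun i => y i.castSucc :=
    hφ.comp (measurable_pi_lambda _ fun i => measurable_pi_apply _)
  obtain ⟨_, ⟨P, hP, rfl⟩, hlim⟩ := (hCC.iidFamily hX hmoment).exists_tendsto_of_measurable
    hLH hlo hhi (Nat.le_add_left 1 d) hφ'
  exact ⟨P, hP, measure_limEvent_eq_one (φ := fun x => φ fun i : Fin d => x i) hX.mem hlim⟩

theorem exists_limEvent_of_memLc (hCC : S.CC Pfam) (hX : S.IsIID X)
    (hmoment : choquet S.upCap (fun ω => |X 0 ω|) < ⊤) (hLH : L ≤ H)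
    (hlo : Tendsto (fun n : ℕ => lowerMean (seqLaw hX.mem '' Pfam) n) atTop (𝓝 L))
    (hhi : Tendsto (fun n : ℕ => upperMean (seqLaw hX.mem '' Pfam) n) atTop (𝓝 H))
    {φ : (ℕ → ℝ) → ℝ} (hφ : S.MemLc Pfam X φ) :
    ∃ P ∈ Pfam, P.1 (limEvent X L H fun ω => φ fun i => X i ω) = 1 := by
  have h𝒬 := hCC.iidFamily hX hmoment
  obtain ⟨Y, hY, hYφ⟩ := h𝒬.exists_cyl_tendsto_ae hφ.1 fun ε hε => by
    refine (hφ.2 ε hε).imp fun f hf => Set.forall_mem_image.2 fun P hP => ?_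
    rw [lintegral_seqLaw _ _ (hφ.1.edist f.continuous.measurable)]
    simp only [edist_dist, Real.dist_eq]
    exact (iSup₂_le_iff.1 hf) P hP
  obtain ⟨_, ⟨P, hP, rfl⟩, hlim⟩ := h𝒬.exists_tendsto_of_cyl_tendsto_ae hLH hlo hhi hY hYφ
  exact ⟨P, hP, measure_limEvent_eq_one hX.mem hlim⟩

end CC

theorem memLc_clamp (hLH : L ≤ H) {φ : (ℕ → ℝ) → ℝ} (hφ : Continuous φ) :
    S.MemLc Pfam X fun x => max L (min (φ x) H) := by
  have hcont : Continuous fun x => max L (min (φ x) H) :=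
    continuous_const.max (hφ.min continuous_const)
  refine ⟨hcont.measurable, fun ε _ => ⟨.ofNormedAddCommGroup _ hcont (max |L| |H|) fun x =>
    abs_le_max_abs_abs (le_max_left _ _) (max_le hLH (min_le_right _ _)), ?_⟩⟩
  simp

end SubLinSpace

end SubLin

end

open SubLin SubLin.SubLinSpace

theorem corollary2p1 {Ω : Type*} [MeasurableSpace Ω] (S : SubLin.SubLinSpace Ω)
    (X : ℕ → Ω → ℝ) (hX : S.IsIID X)
    (hmoment : SubLin.choquet S.upCap (fun ω => |X 0 ω|) < ⊤)
    (Pfam : Set S.Prob) (hCC : S.CC Pfam) :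
    ∃ μlo μhi : ℝ,
      -- the upper and lower means, as limits of truncated expectations
      S.IsTruncMean (X 0) μhi ∧ S.IsTruncMean (fun ω => -X 0 ω) (-μlo) ∧
      -- (a) finite-dimensional Borel functions
      (∀ (d : ℕ) (φ : (Fin d → ℝ) → ℝ), Measurable φ →
        ∃ Q : S.Prob,
          (∀ Y ∈ S.Hb, ((∫ ω, Y ω ∂Q.1 : ℝ) : EReal) ≤ S.E Y) ∧
          S.outCap (SubLin.limEvent X μlo μhi (fun ω => φ (fun i => X i ω))) = 1 ∧
          Q.1 (SubLin.limEvent X μlo μhi (fun ω => φ (fun i => X i ω))) = 1) ∧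
      -- (b) continuous functions of the whole sequence
      (∀ φ : (ℕ → ℝ) → ℝ, Continuous φ →
        ∃ P ∈ Pfam,
          S.outCap (SubLin.limEvent X μlo μhi (fun ω => φ (fun i => X i ω))) = 1 ∧
          P.1 (SubLin.limEvent X μlo μhi (fun ω => φ (fun i => X i ω))) = 1) ∧
      -- the extension of (b) to the space `𝕃_c`
      (∀ φ : (ℕ → ℝ) → ℝ, S.MemLc Pfam X φ →
        ∃ P ∈ Pfam,
          S.outCap (SubLin.limEvent X μlo μhi (fun ω => φ (fun i => X i ω))) = 1 ∧
          P.1 (SubLin.limEvent X μlo μhi (fun ω => φ (fun i => X i ω))) = 1) := by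
  obtain ⟨L, H, hLH, hH, hL, hlo, hhi⟩ := hCC.exists_isTruncMean hX hmoment
  have outCap_and : ∀ P ∈ Pfam, ∀ A : Set Ω, P.1 A = 1 → S.outCap A = 1 ∧ P.1 A = 1 :=
    fun P hP A hA => ⟨(hCC.dominates hP).outCap_eq_one hA, hA⟩
  refine ⟨L, H, hH, hL, fun d φ hφ => ?_, fun φ hφ => ?_, fun φ hφ => ?_⟩
  · obtain ⟨P, hP, hlim⟩ := hCC.exists_limEvent_of_measurable hX hmoment hLH hlo hhi hφ
    exact ⟨P, hCC.dominates hP, outCap_and P hP _ hlim⟩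
  · obtain ⟨P, hP, hlim⟩ :=
      hCC.exists_limEvent_of_memLc hX hmoment hLH hlo hhi (memLc_clamp hLH hφ)
    rw [limEvent_clamp hLH] at hlim
    exact ⟨P, hP, outCap_and P hP _ hlim⟩
  · obtain ⟨P, hP, hlim⟩ := hCC.exists_limEvent_of_memLc hX hmoment hLH hlo hhi hφ
    exact ⟨P, hP, outCap_and P hP _ hlim⟩
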